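/- Theorem 4 (Multinomial Logistic Model). Let $K\ge 1$, let $X$ be a random element of $L^1[0,1]$ with law $G$ such that $\|X\|_1=\int_0^1|X(t)|\,dt$ is bounded almost surely, and for coefficient functions $\beta=(\beta_1,\dots,\beta_{K-1})$ on $[0,1]$ put $$\pi_{\beta,k}(X)=\frac{\exp[\int\beta_k(t)X(t)\,dt]}{1+\sum_{l=1}^{K-1}\exp[\int\beta_l(t)X(t)\,dt]}\ (1\le k\le K-1),\qquad \pi_{\beta,K}(X)=\frac{1}{1+\sum_{l=1}^{K-1}\exp[\int\beta_l(t)X(t)\,dt]}.$$ Let $(X_i,Y_i)$, $i=1,\dots,n$, be i.i.d. with $X_i\sim G$ and $P(Y_i=k\mid X_i)=\pi_{0k}(X_i):=\pi_{\beta_0,k}(X_i)$ for true coefficient functions $\beta_0=(\beta_{01},\dots,\beta_{0,K-1})$. For every $J\ge 1$ let $\psi=\psi_J=(\psi_{J,1},\dots,\psi_{J,J})$ be measurable functions on $[0,1]$. The prior on $\beta$ draws $J$ from a law $\Pi$ on the nonnegative integers and then, given $J$, independent vectors $\theta_1,\dots,\theta_{K-1}\in\mathbb R^J$, and sets $\beta_k=\theta_k^T\psi_J$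 (zero if $J=0$). Suppose that there are constants $\alpha>0$, $K_0\ge 0$, $H$ such that the following hold. (A1) For some $c_1,c_2>0$ and $0\le t_2\le t_1\le 1$, $\exp\{-c_1 j\log^{t_1}j\}\le\Pi(J=j)\le\exp\{-c_2 j\log^{t_2}j\}$ for all sufficiently large $j$. (A2) For each $k$, with constants independent of $J\ge1$: there are $c_3,\varepsilon_0>0$ and $b\ge0$ such that $\Pi(\|\theta_k-\vartheta\|_2\le\epsilon\mid J)\ge\exp\{-c_3J\log(1/\epsilon)\}$ whenever $\|\vartheta\|_\infty\le H$ and $0<\epsilon\le\varepsilon_0J^{-b}$; and there are $C,t_3>0$ such that $\Pi(\theta_k\notin[-M,M]^J\mid J)\le J\exp\{-CM^{t_3}\}$ for all sufficiently large $M$. (5.10) For each $k$ there is a constant $C'>0$ such that for every $J\ge1$ there is $\vartheta\in\mathbb R^J$ with $\|\vartheta\|_\infty\le H$ and $\sup_t|\beta_{0k}(t)-\vartheta^T\psi_J(t)|\le C'J^{-\alpha}$. (5.11) There is a constant $C''>0$ such that $\sup_t|\vartheta_1^T\psi_J(t)-\vartheta_2^T\psi_J(t)|\le C''J^{K_0}\|\vartheta_1-\vartheta_2\|_2$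 for all $J\ge1$ and $\vartheta_1,\vartheta_2\in\mathbb R^J$. Then the posterior contracts at every rate $\epsilon_n>0$ with $\epsilon_n\asymp n^{-\alpha/(2\alpha+1)}(\log n)^{\alpha/(2\alpha+1)+(1-t_2)/2}$ relative to $$d(\pi,\pi_0)=\Big(\sum_{k=1}^K E_X|\pi_k(X)-\pi_{0k}(X)|^2\Big)^{1/2};$$ that is, for every $M_n\to\infty$, the posterior probability $\Pi\big(\beta: d(\pi_\beta,\pi_0)\ge M_n\epsilon_n\mid (X_1,Y_1),\dots,(X_n,Y_n)\big)$ tends to $0$ in probability under the true law of the data. -/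

import Mathlib

open MeasureTheory Filter Topology

/-- A functional covariate: an integrable function on the unit interval (up to null sets).
Its norm is `∫ |x(t)| dt`. -/
abbrev Covariate : Type := Lp ℝ 1 (volume : Measure unitInterval)

noncomputable instance Covariate.instMeasurableSpace : MeasurableSpace Covariate := borel Covariate

instance Covariate.instBorelSpace : BorelSpace Covariate := ⟨rfl⟩

/-- The inner product `∫ β(t) x(t) dt` of a coefficient function with a covariate. -/
noncomputable def linearPredictor (β : unitInterval → ℝ) (x : Covariate) : ℝ :=
  ∫ t, β t * x t

/-- The category probabilities of the multinomial logistic model with `K = m + 1` categories and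
coefficient functions `β 0, …, β (m - 1)`; the last category is the reference category, whose
coefficient function is zero. -/
noncomputable def categoryProb {m : ℕ} (β : Fin m → unitInterval → ℝ) (x : Covariate) :
    Fin (m + 1) → ℝ :=
  Fin.lastCases
    (1 / (1 + ∑ l, Real.exp (linearPredictor (β l) x)))
    (fun k => Real.exp (linearPredictor (β k) x) /
      (1 + ∑ l, Real.exp (linearPredictor (β l) x)))

/-- The distance `d(π, π₀) = (∑ₖ E |πₖ(X) - π₀ₖ(X)|²)^{1/2}` between the category probabilities
given by two vectors of coefficient functions, where `X` has law `G`. -/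
noncomputable def probDist {m : ℕ} (G : Measure Covariate) (β β₀ : Fin m → unitInterval → ℝ) : ℝ :=
  Real.sqrt (∑ k, ∫ x, |categoryProb β x k - categoryProb β₀ x k| ^ 2 ∂G)

/-- The joint law of one observation `(X, Y)`: `X` has law `G`, and given `X` the category `Y` has
the logistic probabilities with coefficient functions `β`. -/
noncomputable def observationLaw {m : ℕ} (G : Measure Covariate)
    (β : Fin m → unitInterval → ℝ) : Measure (Covariate × Fin (m + 1)) :=
  (G.prod Measure.count).withDensity fun z => ENNReal.ofReal (categoryProb β z.1 z.2)

/-- The joint law of `n` independent observations. -/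
noncomputable def sampleLaw {m : ℕ} (G : Measure Covariate)
    (β : Fin m → unitInterval → ℝ) (n : ℕ) : Measure (Fin n → Covariate × Fin (m + 1)) :=
  Measure.pi fun _ => observationLaw G β

/-- The function `θᵀψ` on the unit interval, for basis functions `ψ 0, …, ψ (J - 1)`. -/
noncomputable def series {J : ℕ} (ψ : Fin J → unitInterval → ℝ) (θ : EuclideanSpace ℝ (Fin J)) :
    unitInterval → ℝ :=
  fun t => ∑ j, θ j * ψ j t

/-- The parameters of a finite random series: the number `J` of basis functions, and for each of
the `m` coefficient functions a coefficient vector in `ℝ^J`. -/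
abbrev SeriesParam (m : ℕ) : Type := Σ J : ℕ, Fin m → EuclideanSpace ℝ (Fin J)

/-- The coefficient functions that belong to a parameter. -/
noncomputable def SeriesParam.coeff {m : ℕ} (ψ : (J : ℕ) → Fin J → unitInterval → ℝ)
    (s : SeriesParam m) : Fin m → unitInterval → ℝ :=
  fun k => series (ψ s.1) (s.2 k)

/-- The finite random series prior: `J` is drawn from `p`, and given `J` the coefficient vectors
`θ₁, …, θ_m` are independent with laws `Q J 0, …, Q J (m - 1)`. -/
noncomputable def seriesPrior {m : ℕ} (p : PMF ℕ)
    (Q : (J : ℕ) → Fin m → Measure (EuclideanSpace ℝ (Fin J))) : Measure (SeriesParam m) :=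
  Measure.sum fun J => p J • (Measure.pi (Q J)).map (Sigma.mk J)

/-- The likelihood of the data `z = (xᵢ, yᵢ)ᵢ` at the coefficient functions `β`. -/
noncomputable def likelihood {m n : ℕ} (β : Fin m → unitInterval → ℝ)
    (z : Fin n → Covariate × Fin (m + 1)) : ENNReal :=
  ∏ i, ENNReal.ofReal (categoryProb β (z i).1 (z i).2)

/-- The posterior probability, by the Bayes formula, that the parameter lies in `B`, given the
data `z`. The denominator lies in `(0, 1]` for every probability measure `prior`. -/
noncomputable def posterior {m n : ℕ} (ψ : (J : ℕ) → Fin J → unitInterval → ℝ)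
    (prior : Measure (SeriesParam m)) (z : Fin n → Covariate × Fin (m + 1))
    (B : Set (SeriesParam m)) : ENNReal :=
  (∫⁻ s in B, likelihood (s.coeff ψ) z ∂prior) / ∫⁻ s, likelihood (s.coeff ψ) z ∂prior

/-- The condition on the prior of the number of basis functions:
`exp (-c₁ j log^{t₁} j) ≤ p(j) ≤ exp (-c₂ j log^{t₂} j)`.
It is asked for all large `j`; at `j = 1` the lower bound would read `p(1) = 1` if `t₁ > 0`. -/
def DimensionPriorCondition (p : PMF ℕ) (t₁ t₂ : ℝ) : Prop :=
  0 ≤ t₂ ∧ t₂ ≤ t₁ ∧ t₁ ≤ 1 ∧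
    ∃ c₁ > 0, ∃ c₂ > 0, ∀ᶠ j : ℕ in atTop,
      Real.exp (-c₁ * j * Real.log j ^ t₁) ≤ (p j).toReal ∧
      (p j).toReal ≤ Real.exp (-c₂ * j * Real.log j ^ t₂)

/-- The condition on the prior of a coefficient vector given `J`, with constants that do not depend
on `J`: small balls around every `θ₀` in the cube `[-H, H]^J` have mass at least
`exp (-c₃ J log (1/ε))`, and the complement of `[-M, M]^J` has mass at most `J exp (-C M^{t₃})` for
large `M`. The threshold below which `ε` counts as small may decrease polynomially in `J`: no
sequence of laws satisfies the lower bound with a threshold that is the same for all `J`, because a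
fixed cube contains more than `J^{J/4}` disjoint balls of a fixed small radius when `J` is large. -/
def CoefficientPriorCondition (Q : (J : ℕ) → Measure (EuclideanSpace ℝ (Fin J))) (H : ℝ) : Prop :=
  (∃ c₃ > 0, ∃ ε₀ > 0, ∃ b ≥ (0 : ℝ), ∀ J : ℕ, 1 ≤ J →
    ∀ θ₀ : EuclideanSpace ℝ (Fin J), (∀ j, |θ₀ j| ≤ H) →
    ∀ ε : ℝ, 0 < ε → ε ≤ ε₀ * (J : ℝ) ^ (-b) →
      Real.exp (-c₃ * J * Real.log (1 / ε)) ≤ (Q J).real {θ | ‖θ - θ₀‖ ≤ ε}) ∧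
  (∃ C > 0, ∃ t₃ > 0, ∀ᶠ M : ℝ in atTop, ∀ J : ℕ, 1 ≤ J →
    (Q J).real {θ | ¬ ∀ j, θ j ∈ Set.Icc (-M) M} ≤ J * Real.exp (-C * M ^ t₃))

/-- Approximation of `β₀` in supremum norm at rate `J^{-α}` by series whose coefficients are
bounded by `H`. -/
def ApproximationCondition (ψ : (J : ℕ) → Fin J → unitInterval → ℝ) (β₀ : unitInterval → ℝ)
    (H α : ℝ) : Prop :=
  ∃ C > 0, ∀ J : ℕ, 1 ≤ J → ∃ θ₀ : EuclideanSpace ℝ (Fin J), (∀ j, |θ₀ j| ≤ H) ∧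
    ∀ t, |β₀ t - series (ψ J) θ₀ t| ≤ C * (J : ℝ) ^ (-α)

/-- The supremum distance of two series is at most a constant times `J^{K₀}` times the Euclidean
distance of their coefficient vectors. -/
def BasisLipschitzCondition (ψ : (J : ℕ) → Fin J → unitInterval → ℝ) (K₀ : ℝ) : Prop :=
  ∃ C > 0, ∀ J : ℕ, 1 ≤ J → ∀ θ₁ θ₂ : EuclideanSpace ℝ (Fin J),
    ∀ t, |series (ψ J) θ₁ t - series (ψ J) θ₂ t| ≤ C * (J : ℝ) ^ K₀ * ‖θ₁ - θ₂‖

/-- Posterior contraction at rate `ε` around `β₀` in the distance `probDist G`: for every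
`Mₙ → ∞`, the posterior probability of `{d(π, π₀) ≥ Mₙ εₙ}` tends to zero in probability under the
law of `n` independent observations from `β₀`. -/
def PosteriorContractsAtRate {m : ℕ} (G : Measure Covariate)
    (ψ : (J : ℕ) → Fin J → unitInterval → ℝ) (prior : Measure (SeriesParam m))
    (β₀ : Fin m → unitInterval → ℝ) (ε : ℕ → ℝ) : Prop :=
  ∀ M : ℕ → ℝ, Tendsto M atTop atTop → ∀ δ : ENNReal, 0 < δ →
    Tendsto (fun n : ℕ => sampleLaw G β₀ n
        {z | δ ≤ posterior ψ prior z {s | M n * ε n ≤ probDist G (s.coeff ψ) β₀}})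
      atTop (𝓝 0)

open scoped ENNReal

/-! The posterior probability of a set is a quotient of two prior integrals of the likelihood ratio
against the truth. The denominator is shown to be rarely small. The numerator over the parameters
far from the truth is split by a sieve, namely at most `N` basis functions with coefficients in
`[-n^q, n^q]`, and both pieces are shown to be small. `sampleLaw_posterior_ge_le` combines the three
bounds for fixed `n`.

Denominator: where the linear predictors are within `δ` of the true ones, the inverse ratio has mean
at most `exp (16 n δ²)`, a chi-square bound. By Cauchy–Schwarz the integrated ratio can be small
only if the integrated inverse ratio is large, and Markov's inequality excludes this
(`sampleLaw_evidence_lt_le`).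

Numerator off the sieve: the ratio has mean one under the truth, so Fubini and Markov leave only the
prior mass of the complement. Numerator on the sieve: the Hellinger affinity is at most `exp
(-d²/8)`, so the ratio at one parameter at distance `d` exceeds `exp (-v)` with probability at most
`exp (v/2 - n d²/8)`. Changing the coefficient functions by `η` in supremum norm changes the log
likelihood by at most a multiple of `n η`, since the covariates are bounded in `L¹`. A union bound
over a polynomially fine grid is therefore enough, and no tests have to be built.

Rates: let `e = 1/(2α+1)`. About `(n / log n)^e` basis functions balance approximation error and
prior mass, so the evidence costs `exp (-C₁ T)` with `T = n^e (log n)^(1-e)`. For the prior to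
neglect dimensions above `N` at this cost, `N log^{t₂} N` must be a large multiple of `T`. The
entropy of the sieve is then of order `N log n`, that is `v = T (log n)^(1-t₂)`, and this is exactly
`n` times the squared rate. The gap between `T` and `v` is the logarithmic loss in the rate. -/

/-- Coefficient functions that are measurable and bounded. -/
def BoundedMeasurable (β : unitInterval → ℝ) : Prop :=
  Measurable β ∧ ∃ B, ∀ t, |β t| ≤ B

/-! ### The linear predictor as a functional of the covariate -/

namespace BoundedMeasurable

variable {β γ : unitInterval → ℝ}

lemma integrable_mul (hβ : BoundedMeasurable β) (x : Covariate) :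
    Integrable fun t => β t * x t := by
  obtain ⟨hm, B, hB⟩ := hβ
  exact (L1.integrable_coeFn x).bdd_mul hm.aestronglyMeasurable
    (Eventually.of_forall fun t => by simpa using hB t)

lemma abs_linearPredictor_sub_le (hβ : BoundedMeasurable β) (hγ : BoundedMeasurable γ) {η : ℝ}
    (h : ∀ t, |β t - γ t| ≤ η) (x : Covariate) :
    |linearPredictor β x - linearPredictor γ x| ≤ η * ‖x‖ := by
  unfold linearPredictor
  rw [← integral_sub (hβ.integrable_mul x) (hγ.integrable_mul x), L1.norm_eq_integral_norm,
    ← integral_const_mul]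
  rw [← Real.norm_eq_abs]
  refine norm_integral_le_of_norm_le ((L1.integrable_coeFn x).norm.const_mul η)
    (Eventually.of_forall fun t => ?_)
  rw [← sub_mul, norm_mul]
  exact mul_le_mul_of_nonneg_right (h t) (norm_nonneg _)

lemma continuous_linearPredictor (hβ : BoundedMeasurable β) : Continuous (linearPredictor β) := by
  obtain ⟨B, hB⟩ := hβ.2
  have hB0 : 0 ≤ B := (abs_nonneg _).trans (hB 0)
  refine (LipschitzWith.of_dist_le_mul (K := ⟨B, hB0⟩) fun x y => ?_).continuous
  have e : linearPredictor β x - linearPredictor β y = linearPredictor β (x - y) := by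
    unfold linearPredictor
    rw [← integral_sub (hβ.integrable_mul x) (hβ.integrable_mul y)]
    refine integral_congr_ae ?_
    filter_upwards [Lp.coeFn_sub x y] with t ht
    rw [ht, Pi.sub_apply, mul_sub]
  have h0 : BoundedMeasurable fun _ => (0 : ℝ) := ⟨measurable_const, 0, by simp⟩
  have h1 := hβ.abs_linearPredictor_sub_le h0 (η := B) (by simpa using hB) (x - y)
  have h2 : linearPredictor (fun _ => (0 : ℝ)) (x - y) = 0 := by simp [linearPredictor]
  rw [h2, sub_zero] at h1
  rw [Real.dist_eq, e, dist_eq_norm]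
  exact h1

end BoundedMeasurable

/-! ### Category probabilities: positivity, stability, measurability -/

section categoryProb

variable {m : ℕ} (β γ : Fin m → unitInterval → ℝ) (x : Covariate)

lemma categoryProb_pos (k : Fin (m + 1)) : 0 < categoryProb β x k := by
  have h : 0 < 1 + ∑ l, Real.exp (linearPredictor (β l) x) :=
    add_pos_of_pos_of_nonneg one_pos (Finset.sum_nonneg fun _ _ => (Real.exp_pos _).le)
  induction k using Fin.lastCases with
  | last => simp only [categoryProb, Fin.lastCases_last]; positivity
  | cast k => simp only [categoryProb, Fin.lastCases_castSucc]; positivity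

lemma sum_categoryProb : ∑ k, categoryProb β x k = 1 := by
  have h : 0 < 1 + ∑ l, Real.exp (linearPredictor (β l) x) :=
    add_pos_of_pos_of_nonneg one_pos (Finset.sum_nonneg fun _ _ => (Real.exp_pos _).le)
  rw [Fin.sum_univ_castSucc]
  simp only [categoryProb, Fin.lastCases_last, Fin.lastCases_castSucc]
  rw [← Finset.sum_div, ← add_div, add_comm, div_self h.ne']

variable {β γ x}

/-- Numerator and denominator each change by a factor of at most `exp δ`. This multiplicative
stability gives both the chi-square bound near the truth and the near constancy of the likelihood on
grid cells. -/
lemma categoryProb_le_exp_mul {δ : ℝ} (hδ : 0 ≤ δ)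
    (h : ∀ l, |linearPredictor (β l) x - linearPredictor (γ l) x| ≤ δ) (k : Fin (m + 1)) :
    categoryProb β x k ≤ Real.exp (2 * δ) * categoryProb γ x k := by
  have hpos : ∀ b : Fin m → unitInterval → ℝ, 0 < 1 + ∑ l, Real.exp (linearPredictor (b l) x) :=
    fun b => add_pos_of_pos_of_nonneg one_pos (Finset.sum_nonneg fun _ _ => (Real.exp_pos _).le)
  have hden : 1 + ∑ l, Real.exp (linearPredictor (γ l) x) ≤
      Real.exp δ * (1 + ∑ l, Real.exp (linearPredictor (β l) x)) := by
    rw [mul_add, Finset.mul_sum]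
    refine add_le_add (by simpa using hδ) (Finset.sum_le_sum fun l _ => ?_)
    rw [← Real.exp_add]
    exact Real.exp_le_exp.2 (by linarith [(abs_le.1 (h l)).1])
  have key : ∀ a b : ℝ, 0 ≤ b → a ≤ Real.exp δ * b →
      a / (1 + ∑ l, Real.exp (linearPredictor (β l) x)) ≤
        Real.exp (2 * δ) * (b / (1 + ∑ l, Real.exp (linearPredictor (γ l) x))) := by
    intro a b hb hab
    rw [← mul_div_assoc, div_le_div_iff₀ (hpos β) (hpos γ)]
    calc a * (1 + ∑ l, Real.exp (linearPredictor (γ l) x))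
        ≤ (Real.exp δ * b) * (Real.exp δ * (1 + ∑ l, Real.exp (linearPredictor (β l) x))) :=
          mul_le_mul hab hden (hpos γ).le (by positivity)
      _ = _ := by rw [two_mul, Real.exp_add]; ring
  induction k using Fin.lastCases with
  | last =>
    simp only [categoryProb, Fin.lastCases_last]
    exact key 1 1 zero_le_one (by simpa using hδ)
  | cast k =>
    simp only [categoryProb, Fin.lastCases_castSucc]
    refine key _ _ (Real.exp_pos _).le ?_
    rw [← Real.exp_add]
    exact Real.exp_le_exp.2 (by linarith [(abs_le.1 (h k)).2])

lemma measurable_categoryProb_of {Ω : Type*} [MeasurableSpace Ω]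
    {b : Ω → Fin m → unitInterval → ℝ} {X : Ω → Covariate}
    (h : ∀ l, Measurable fun ω => linearPredictor (b ω l) (X ω)) (k : Fin (m + 1)) :
    Measurable fun ω => categoryProb (b ω) (X ω) k := by
  induction k using Fin.lastCases with
  | last => simp only [categoryProb, Fin.lastCases_last]; fun_prop
  | cast k =>
    simp only [categoryProb, Fin.lastCases_castSucc]
    have := h k
    fun_prop

lemma measurable_categoryProb (hβ : ∀ l, BoundedMeasurable (β l)) (k : Fin (m + 1)) :
    Measurable fun x => categoryProb β x k :=
  measurable_categoryProb_of (b := fun _ => β) (X := id)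
    (fun l => (hβ l).continuous_linearPredictor.measurable) k

lemma measurable_categoryProb_uncurry (hβ : ∀ l, BoundedMeasurable (β l)) :
    Measurable fun z : Covariate × Fin (m + 1) => categoryProb β z.1 z.2 :=
  measurable_from_prod_countable_left fun k => measurable_categoryProb hβ k

end categoryProb

theorem lintegral_pi_prod_eq_pow {α : Type*} [MeasurableSpace α] (μ : Measure α) [SigmaFinite μ]
    {f : α → ℝ≥0∞} (hf : Measurable f) (n : ℕ) :
    ∫⁻ z : Fin n → α, ∏ i, f (z i) ∂(Measure.pi fun _ => μ) = (∫⁻ a, f a ∂μ) ^ n := by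
  induction n with
  | zero => simp
  | succ n ih =>
    have hm : Measurable fun z : Fin n → α => ∏ i, f (z i) :=
      Finset.measurable_prod _ fun i _ => hf.comp (measurable_pi_apply i)
    have e := ((measurePreserving_piFinSuccAbove (fun _ : Fin (n + 1) => μ) 0).symm).lintegral_comp
      (f := fun z : Fin (n + 1) → α => ∏ i, f (z i))
      (Finset.measurable_prod _ fun i _ => hf.comp (measurable_pi_apply i))
    rw [← e, pow_succ', ← ih, ← lintegral_prod_mul hf.aemeasurable hm.aemeasurable]
    refine lintegral_congr fun z => ?_
    simp [MeasurableEquiv.piFinSuccAbove_symm_apply, Fin.insertNthEquiv, Fin.prod_univ_succ]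

/-! ### Moments of the likelihood ratio for one observation -/

section observationLaw

variable {m : ℕ} {G : Measure Covariate}
  {β γ : Fin m → unitInterval → ℝ}

lemma lintegral_observationLaw (hγ : ∀ l, BoundedMeasurable (γ l))
    {f : Covariate × Fin (m + 1) → ℝ≥0∞} (hf : Measurable f) :
    ∫⁻ z, f z ∂(observationLaw G γ) =
      ∫⁻ x, ∑ k, ENNReal.ofReal (categoryProb γ x k) * f (x, k) ∂G := by
  have hc : Measurable fun z : Covariate × Fin (m + 1) =>
      ENNReal.ofReal (categoryProb γ z.1 z.2) := (measurable_categoryProb_uncurry hγ).ennreal_ofReal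
  rw [observationLaw, lintegral_withDensity_eq_lintegral_mul _ hc hf,
    lintegral_prod _ (hc.mul hf).aemeasurable]
  simp [lintegral_count, tsum_fintype]

lemma lintegral_ofReal_observationLaw (hγ : ∀ l, BoundedMeasurable (γ l))
    {g : Covariate × Fin (m + 1) → ℝ} (hg : Measurable g) (h0 : ∀ z, 0 ≤ g z) :
    ∫⁻ z, ENNReal.ofReal (g z) ∂(observationLaw G γ) =
      ∫⁻ x, ENNReal.ofReal (∑ k, categoryProb γ x k * g (x, k)) ∂G := by
  rw [lintegral_observationLaw hγ hg.ennreal_ofReal]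
  refine lintegral_congr fun x => ?_
  rw [ENNReal.ofReal_sum_of_nonneg
    fun k _ => mul_nonneg (categoryProb_pos γ x k).le (h0 _)]
  exact Finset.sum_congr rfl fun k _ => (ENNReal.ofReal_mul (categoryProb_pos γ x k).le).symm

variable [IsProbabilityMeasure G]

lemma isProbabilityMeasure_observationLaw (hγ : ∀ l, BoundedMeasurable (γ l)) :
    IsProbabilityMeasure (observationLaw G γ) := by
  constructor
  have h := lintegral_ofReal_observationLaw (G := G) hγ (g := fun _ => 1) measurable_const
    fun _ => zero_le_one
  simpa [sum_categoryProb] using h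

/-- The likelihood ratio of two vectors of coefficient functions, for one observation. -/
noncomputable def likelihoodRatio (β γ : Fin m → unitInterval → ℝ)
    (z : Covariate × Fin (m + 1)) : ℝ :=
  categoryProb β z.1 z.2 / categoryProb γ z.1 z.2

lemma likelihoodRatio_pos (z : Covariate × Fin (m + 1)) : 0 < likelihoodRatio β γ z :=
  div_pos (categoryProb_pos _ _ _) (categoryProb_pos _ _ _)

lemma measurable_likelihoodRatio (hβ : ∀ l, BoundedMeasurable (β l))
    (hγ : ∀ l, BoundedMeasurable (γ l)) : Measurable (likelihoodRatio β γ) :=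
  (measurable_categoryProb_uncurry hβ).div (measurable_categoryProb_uncurry hγ)

lemma lintegral_likelihoodRatio (hβ : ∀ l, BoundedMeasurable (β l))
    (hγ : ∀ l, BoundedMeasurable (γ l)) :
    ∫⁻ z, ENNReal.ofReal (likelihoodRatio β γ z) ∂(observationLaw G γ) = 1 := by
  rw [lintegral_ofReal_observationLaw hγ (measurable_likelihoodRatio hβ hγ)
    fun z => (likelihoodRatio_pos z).le]
  have : ∀ x, ∑ k, categoryProb γ x k * likelihoodRatio β γ (x, k) = 1 := fun x => by
    rw [← sum_categoryProb β x]
    exact Finset.sum_congr rfl fun k _ => mul_div_cancel₀ _ (categoryProb_pos γ x k).ne'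
  simp [this]

/-- The sum is one plus the chi-square divergence. With `r` the ratio of the two probabilities of a
category, `r² = 2 r - 1 + (r - 1)²`; the linear part sums to one, and `|r - 1| ≤ 4 δ` because `r`
lies between `exp (-2 δ)` and `exp (2 δ)` with `2 δ ≤ 1`. -/
lemma sum_mul_likelihoodRatio_symm_le {x : Covariate} {δ : ℝ} (hδ0 : 0 ≤ δ) (hδ : δ ≤ 1 / 2)
    (h : ∀ l, |linearPredictor (β l) x - linearPredictor (γ l) x| ≤ δ) :
    ∑ k, categoryProb γ x k * likelihoodRatio γ β (x, k) ≤ Real.exp (16 * δ ^ 2) := by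
  have hk : ∀ k, categoryProb γ x k * likelihoodRatio γ β (x, k) ≤
      2 * categoryProb γ x k - categoryProb β x k + 16 * δ ^ 2 * categoryProb β x k := fun k => by
    have hb := categoryProb_pos β x k
    have h1 := categoryProb_le_exp_mul hδ0 h k
    have h2 := categoryProb_le_exp_mul (β := γ) (γ := β) hδ0
      (fun l => by rw [abs_sub_comm]; exact h l) k
    set r := likelihoodRatio γ β (x, k) with hr
    have hg : categoryProb γ x k = r * categoryProb β x k := by
      rw [hr, likelihoodRatio, div_mul_cancel₀ _ hb.ne']
    have hr2 : r ≤ Real.exp (2 * δ) := by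
      rw [hg] at h2; exact le_of_mul_le_mul_right h2 hb
    have hr1 : Real.exp (-(2 * δ)) ≤ r := by
      rw [Real.exp_neg, inv_le_iff_one_le_mul₀ (Real.exp_pos _)]
      rw [hg, ← mul_assoc] at h1
      refine le_of_mul_le_mul_right ?_ hb
      linarith
    have e1 := (abs_le.1 (Real.abs_exp_sub_one_le (x := 2 * δ)
      (by rw [abs_of_nonneg] <;> linarith))).2
    have e2 := (abs_le.1 (Real.abs_exp_sub_one_le (x := -(2 * δ))
      (by rw [abs_neg, abs_of_nonneg] <;> linarith))).1
    rw [abs_of_nonneg (by linarith)] at e1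
    rw [abs_neg, abs_of_nonneg (by linarith)] at e2
    have hs : (r - 1) ^ 2 ≤ 16 * δ ^ 2 := by
      have : |r - 1| ≤ |4 * δ| := by
        rw [abs_of_nonneg (by linarith : 0 ≤ 4 * δ), abs_le]; constructor <;> linarith
      calc (r - 1) ^ 2 ≤ (4 * δ) ^ 2 := sq_le_sq.2 this
        _ = _ := by ring
    rw [hg]
    nlinarith [mul_le_mul_of_nonneg_right hs hb.le]
  calc _ ≤ ∑ k, (2 * categoryProb γ x k - categoryProb β x k
        + 16 * δ ^ 2 * categoryProb β x k) := Finset.sum_le_sum fun k _ => hk k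
    _ = 16 * δ ^ 2 + 1 := by
      rw [Finset.sum_add_distrib, Finset.sum_sub_distrib, ← Finset.mul_sum, ← Finset.mul_sum,
        sum_categoryProb, sum_categoryProb]; ring
    _ ≤ _ := Real.add_one_le_exp _

lemma lintegral_likelihoodRatio_symm_le (hβ : ∀ l, BoundedMeasurable (β l))
    (hγ : ∀ l, BoundedMeasurable (γ l)) {δ : ℝ} (hδ0 : 0 ≤ δ) (hδ : δ ≤ 1 / 2)
    (h : ∀ᵐ x ∂G, ∀ l, |linearPredictor (β l) x - linearPredictor (γ l) x| ≤ δ) :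
    ∫⁻ z, ENNReal.ofReal (likelihoodRatio γ β z) ∂(observationLaw G γ) ≤
      ENNReal.ofReal (Real.exp (16 * δ ^ 2)) := by
  rw [lintegral_ofReal_observationLaw hγ (measurable_likelihoodRatio hγ hβ)
    fun z => (likelihoodRatio_pos z).le]
  calc _ ≤ ∫⁻ _, ENNReal.ofReal (Real.exp (16 * δ ^ 2)) ∂G := by
        refine lintegral_mono_ae ?_
        filter_upwards [h] with x hx
        exact ENNReal.ofReal_le_ofReal (sum_mul_likelihoodRatio_symm_le hδ0 hδ hx)
    _ = _ := by simp

/-- With `a = u²` and `b = v²` the gap between the two means is `(u - v)² / 2`, while `(a - b)² = (u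
- v)² (u + v)² ≤ 4 (u - v)²`. This is the comparison of Hellinger and squared distance for numbers
in `[0, 1]`. -/
lemma sqrt_mul_le_half_add_sub {a b : ℝ} (ha : 0 ≤ a) (hb : 0 ≤ b) (ha1 : a ≤ 1) (hb1 : b ≤ 1) :
    √(a * b) ≤ (a + b) / 2 - |a - b| ^ 2 / 8 := by
  obtain ⟨u, hu, rfl⟩ : ∃ u, 0 ≤ u ∧ a = u ^ 2 := ⟨√a, Real.sqrt_nonneg _, (Real.sq_sqrt ha).symm⟩
  obtain ⟨v, hv, rfl⟩ : ∃ v, 0 ≤ v ∧ b = v ^ 2 := ⟨√b, Real.sqrt_nonneg _, (Real.sq_sqrt hb).symm⟩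
  rw [← mul_pow, Real.sqrt_sq (mul_nonneg hu hv), sq_abs]
  have hu1 : u ≤ 1 := by nlinarith
  have hv1 : v ≤ 1 := by nlinarith
  have : (u + v) ^ 2 ≤ 4 := by nlinarith
  nlinarith [mul_le_mul_of_nonneg_left this (sq_nonneg (u - v))]

lemma probDist_sq (G : Measure Covariate) (β γ : Fin m → unitInterval → ℝ) :
    probDist G β γ ^ 2 = ∑ k, ∫ x, |categoryProb β x k - categoryProb γ x k| ^ 2 ∂G :=
  Real.sq_sqrt (Finset.sum_nonneg fun _ _ => integral_nonneg fun _ => by positivity)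

lemma categoryProb_le_one (β : Fin m → unitInterval → ℝ) (x : Covariate) (k : Fin (m + 1)) :
    categoryProb β x k ≤ 1 := by
  rw [← sum_categoryProb β x]
  exact Finset.single_le_sum (fun i _ => (categoryProb_pos β x i).le) (Finset.mem_univ k)

/-- The left side is the Hellinger affinity. Summing the previous inequality over the categories
bounds it by `1 - d²/8`; the exponential form is the one that multiplies over the sample. -/
lemma lintegral_sqrt_likelihoodRatio_le (hβ : ∀ l, BoundedMeasurable (β l))
    (hγ : ∀ l, BoundedMeasurable (γ l)) :
    ∫⁻ z, ENNReal.ofReal √(likelihoodRatio β γ z) ∂(observationLaw G γ) ≤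
      ENNReal.ofReal (Real.exp (-(probDist G β γ ^ 2 / 8))) := by
  rw [lintegral_ofReal_observationLaw hγ (measurable_likelihoodRatio hβ hγ).sqrt
    fun z => Real.sqrt_nonneg _]
  set S : Covariate → ℝ := fun x => ∑ k, |categoryProb β x k - categoryProb γ x k| ^ 2 with hS
  have hi : ∀ k, Integrable (fun x => |categoryProb β x k - categoryProb γ x k| ^ 2) G := fun k => by
    have hm := (measurable_categoryProb hβ k).sub (measurable_categoryProb hγ k)
    refine Integrable.of_bound (C := 1) ((hm.abs.pow_const 2).aestronglyMeasurable)
      (Eventually.of_forall fun x => ?_)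
    have := categoryProb_pos β x k
    have := categoryProb_pos γ x k
    have := categoryProb_le_one β x k
    have := categoryProb_le_one γ x k
    rw [Real.norm_of_nonneg (by positivity)]
    exact pow_le_one₀ (abs_nonneg _) (by rw [abs_le]; constructor <;> linarith)
  have hSi : Integrable S G := integrable_finsetSum _ fun k _ => hi k
  have hle : ∀ x, ∑ k, categoryProb γ x k * √(likelihoodRatio β γ (x, k)) ≤ 1 - S x / 8 := by
    intro x
    calc _ ≤ ∑ k, ((categoryProb β x k + categoryProb γ x k) / 2
          - |categoryProb β x k - categoryProb γ x k| ^ 2 / 8) := by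
          refine Finset.sum_le_sum fun k _ => ?_
          have hb := categoryProb_pos β x k
          have hg := categoryProb_pos γ x k
          refine le_trans (le_of_eq ?_) (sqrt_mul_le_half_add_sub hb.le hg.le
            (categoryProb_le_one β x k) (categoryProb_le_one γ x k))
          rw [← Real.sqrt_sq hg.le, ← Real.sqrt_mul (by positivity), Real.sqrt_sq hg.le,
            likelihoodRatio]
          congr 1
          field_simp
      _ = _ := by
          rw [Finset.sum_sub_distrib, ← Finset.sum_div, ← Finset.sum_div, Finset.sum_add_distrib,
            sum_categoryProb, sum_categoryProb, hS]
          norm_num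
  have h0 : ∀ x, 0 ≤ 1 - S x / 8 := fun x => le_trans (Finset.sum_nonneg fun k _ =>
    mul_nonneg (categoryProb_pos γ x k).le (Real.sqrt_nonneg _)) (hle x)
  calc _ ≤ ∫⁻ x, ENNReal.ofReal (1 - S x / 8) ∂G :=
        lintegral_mono fun x => ENNReal.ofReal_le_ofReal (hle x)
    _ = ENNReal.ofReal (∫ x, (1 - S x / 8) ∂G) :=
        (ofReal_integral_eq_lintegral_ofReal ((integrable_const _).sub (hSi.div_const 8))
          (Eventually.of_forall h0)).symm
    _ ≤ _ := by
        refine ENNReal.ofReal_le_ofReal ?_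
        rw [integral_sub (integrable_const _) (hSi.div_const 8), integral_div, hS,
          integral_finsetSum _ fun k _ => hi k, ← probDist_sq]
        simp only [integral_const, probReal_univ, smul_eq_mul, mul_one]
        linarith [Real.add_one_le_exp (-(probDist G β γ ^ 2 / 8))]

end observationLaw

/-! ### Likelihood ratios of a sample -/

/-- The likelihood ratio of two vectors of coefficient functions, for a sample. -/
noncomputable def sampleRatio {m n : ℕ} (β γ : Fin m → unitInterval → ℝ)
    (z : Fin n → Covariate × Fin (m + 1)) : ℝ≥0∞ :=
  ∏ i, ENNReal.ofReal (likelihoodRatio β γ (z i))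

section sampleRatio

variable {m n : ℕ} {β γ : Fin m → unitInterval → ℝ} {z : Fin n → Covariate × Fin (m + 1)}

lemma sampleRatio_ne_zero : sampleRatio β γ z ≠ 0 :=
  Finset.prod_ne_zero_iff.2 fun _ _ => (ENNReal.ofReal_pos.2 (likelihoodRatio_pos _)).ne'

lemma sampleRatio_ne_top : sampleRatio β γ z ≠ ∞ :=
  ENNReal.prod_ne_top fun _ _ => ENNReal.ofReal_ne_top

lemma sampleRatio_symm : sampleRatio γ β z = (sampleRatio β γ z)⁻¹ := by
  refine ENNReal.eq_inv_of_mul_eq_one_left ?_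
  rw [sampleRatio, sampleRatio, ← Finset.prod_mul_distrib]
  refine Finset.prod_eq_one fun i _ => ?_
  rw [← ENNReal.ofReal_mul (likelihoodRatio_pos _).le, likelihoodRatio, likelihoodRatio,
    div_mul_div_cancel₀ (categoryProb_pos _ _ _).ne', div_self (categoryProb_pos _ _ _).ne',
    ENNReal.ofReal_one]

lemma likelihood_ne_zero : likelihood γ z ≠ 0 :=
  Finset.prod_ne_zero_iff.2 fun _ _ => (ENNReal.ofReal_pos.2 (categoryProb_pos _ _ _)).ne'

lemma likelihood_ne_top : likelihood γ z ≠ ∞ :=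
  ENNReal.prod_ne_top fun _ _ => ENNReal.ofReal_ne_top

lemma likelihood_eq_mul_sampleRatio : likelihood β z = likelihood γ z * sampleRatio β γ z := by
  rw [likelihood, likelihood, sampleRatio, ← Finset.prod_mul_distrib]
  refine Finset.prod_congr rfl fun i _ => ?_
  rw [← ENNReal.ofReal_mul (categoryProb_pos _ _ _).le, likelihoodRatio,
    mul_div_cancel₀ _ (categoryProb_pos _ _ _).ne']

/-- Each of the `n` factors changes by at most `exp (2 η)`. The bound is pointwise in the data,
which is why the covariates must satisfy the norm bound. -/
lemma sampleRatio_le_exp_mul {β' : Fin m → unitInterval → ℝ} {η R : ℝ} (hη : 0 ≤ η)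
    (h : ∀ x : Covariate, ‖x‖ ≤ R → ∀ l, |linearPredictor (β l) x - linearPredictor (β' l) x| ≤ η)
    (hz : ∀ i, ‖(z i).1‖ ≤ R) :
    sampleRatio β γ z ≤ ENNReal.ofReal (Real.exp (2 * n * η)) * sampleRatio β' γ z := by
  have e : ENNReal.ofReal (Real.exp (2 * n * η)) =
      ∏ _i : Fin n, ENNReal.ofReal (Real.exp (2 * η)) := by
    rw [Finset.prod_const, Finset.card_univ, Fintype.card_fin,
      ← ENNReal.ofReal_pow (Real.exp_pos _).le, ← Real.exp_nat_mul]
    congr 2; ring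
  rw [e, sampleRatio, sampleRatio, ← Finset.prod_mul_distrib]
  refine Finset.prod_le_prod' fun i _ => ?_
  rw [← ENNReal.ofReal_mul (Real.exp_pos _).le]
  refine ENNReal.ofReal_le_ofReal ?_
  rw [likelihoodRatio, likelihoodRatio, ← mul_div_assoc]
  exact div_le_div_of_nonneg_right (categoryProb_le_exp_mul hη (h _ (hz i)) _)
    (categoryProb_pos _ _ _).le

variable {G : Measure Covariate} [IsProbabilityMeasure G]

lemma isProbabilityMeasure_sampleLaw (hγ : ∀ l, BoundedMeasurable (γ l)) (n : ℕ) :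
    IsProbabilityMeasure (sampleLaw G γ n) := by
  have := isProbabilityMeasure_observationLaw (G := G) hγ
  unfold sampleLaw
  infer_instance

lemma lintegral_sampleLaw_prod (hγ : ∀ l, BoundedMeasurable (γ l))
    {f : Covariate × Fin (m + 1) → ℝ≥0∞} (hf : Measurable f) :
    ∫⁻ z, ∏ i, f (z i) ∂(sampleLaw G γ n) = (∫⁻ z, f z ∂(observationLaw G γ)) ^ n := by
  have := isProbabilityMeasure_observationLaw (G := G) hγ
  exact lintegral_pi_prod_eq_pow _ hf n

lemma ae_sampleLaw_norm_le (hγ : ∀ l, BoundedMeasurable (γ l)) {R : ℝ}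
    (hG : ∀ᵐ x ∂G, ‖x‖ ≤ R) :
    ∀ᵐ z ∂(sampleLaw G γ n), ∀ i, ‖(z i).1‖ ≤ R := by
  have := isProbabilityMeasure_observationLaw (G := G) hγ
  have h1 : ∀ᵐ w ∂(observationLaw G γ), ‖w.1‖ ≤ R :=
    (withDensity_absolutelyContinuous _ _).ae_le (Measure.quasiMeasurePreserving_fst.ae hG)
  rw [ae_all_iff]
  intro i
  exact (Measure.quasiMeasurePreserving_eval (fun _ : Fin n => observationLaw G γ) i).ae h1

lemma lintegral_sampleRatio (hβ : ∀ l, BoundedMeasurable (β l))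
    (hγ : ∀ l, BoundedMeasurable (γ l)) :
    ∫⁻ z, sampleRatio β γ z ∂(sampleLaw G γ n) = 1 := by
  unfold sampleRatio
  rw [lintegral_sampleLaw_prod hγ (measurable_likelihoodRatio hβ hγ).ennreal_ofReal,
    lintegral_likelihoodRatio hβ hγ, one_pow]

lemma lintegral_sampleRatio_symm_le (hβ : ∀ l, BoundedMeasurable (β l))
    (hγ : ∀ l, BoundedMeasurable (γ l)) {δ : ℝ} (hδ0 : 0 ≤ δ) (hδ : δ ≤ 1 / 2)
    (h : ∀ᵐ x ∂G, ∀ l, |linearPredictor (β l) x - linearPredictor (γ l) x| ≤ δ) :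
    ∫⁻ z, sampleRatio γ β z ∂(sampleLaw G γ n) ≤
      ENNReal.ofReal (Real.exp (16 * n * δ ^ 2)) := by
  unfold sampleRatio
  rw [lintegral_sampleLaw_prod hγ (measurable_likelihoodRatio hγ hβ).ennreal_ofReal]
  calc _ ≤ (ENNReal.ofReal (Real.exp (16 * δ ^ 2))) ^ n :=
        pow_le_pow_left₀ zero_le (lintegral_likelihoodRatio_symm_le hβ hγ hδ0 hδ h) n
    _ = _ := by
        rw [← ENNReal.ofReal_pow (Real.exp_pos _).le, ← Real.exp_nat_mul]; congr 2; ring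

lemma ofReal_exp_inv (a : ℝ) :
    (ENNReal.ofReal (Real.exp a))⁻¹ = ENNReal.ofReal (Real.exp (-a)) := by
  rw [← ENNReal.ofReal_inv_of_pos (Real.exp_pos _), Real.exp_neg]

lemma ofReal_exp_add (a b : ℝ) : ENNReal.ofReal (Real.exp (a + b)) =
    ENNReal.ofReal (Real.exp a) * ENNReal.ofReal (Real.exp b) := by
  rw [Real.exp_add, ENNReal.ofReal_mul (Real.exp_pos _).le]

/-- Markov's inequality with an exponential threshold. -/
lemma measure_exp_neg_le_le {Ω : Type*} [MeasurableSpace Ω] (μ : Measure Ω) {f : Ω → ℝ≥0∞}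
    (hf : AEMeasurable f μ) (v : ℝ) :
    μ {ω | ENNReal.ofReal (Real.exp (-v)) ≤ f ω} ≤
      ENNReal.ofReal (Real.exp v) * ∫⁻ ω, f ω ∂μ := by
  refine (meas_ge_le_lintegral_div hf (ENNReal.ofReal_pos.2 (Real.exp_pos _)).ne'
    ENNReal.ofReal_ne_top).trans (le_of_eq ?_)
  rw [div_eq_mul_inv, ofReal_exp_inv, neg_neg, mul_comm]

/-- Markov's inequality is applied to the square root of the ratio: its mean is the `n`th power of
the affinity, whereas the ratio itself has mean one and would give nothing. -/
lemma sampleLaw_exp_neg_le_sampleRatio_le (hβ : ∀ l, BoundedMeasurable (β l))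
    (hγ : ∀ l, BoundedMeasurable (γ l)) (v : ℝ) :
    sampleLaw G γ n {z | ENNReal.ofReal (Real.exp (-v)) ≤ sampleRatio β γ z} ≤
      ENNReal.ofReal (Real.exp (v / 2 - n * probDist G β γ ^ 2 / 8)) := by
  set w : (Fin n → Covariate × Fin (m + 1)) → ℝ≥0∞ :=
    fun z => ∏ i, ENNReal.ofReal √(likelihoodRatio β γ (z i)) with hw
  have hwm : Measurable w := Finset.measurable_prod _ fun i _ =>
    ((measurable_likelihoodRatio hβ hγ).sqrt.comp (measurable_pi_apply i)).ennreal_ofReal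
  have hww : ∀ z, sampleRatio β γ z = w z ^ 2 := fun z => by
    rw [hw, sampleRatio]
    simp only
    rw [← Finset.prod_pow]
    refine Finset.prod_congr rfl fun i _ => ?_
    rw [← ENNReal.ofReal_pow (Real.sqrt_nonneg _), Real.sq_sqrt (likelihoodRatio_pos _).le]
  have hsub : {z | ENNReal.ofReal (Real.exp (-v)) ≤ sampleRatio β γ z} ⊆
      {z | ENNReal.ofReal (Real.exp (-(v / 2))) ≤ w z} := fun z hz => by
    simp only [Set.mem_ofPred_eq, hww] at hz ⊢
    have e : -v = -(v / 2) + -(v / 2) := by ring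
    rw [e, ofReal_exp_add, ← sq] at hz
    exact (ENNReal.pow_le_pow_left_iff two_ne_zero).1 hz
  refine (measure_mono hsub).trans ((measure_exp_neg_le_le _ hwm.aemeasurable _).trans ?_)
  rw [sub_eq_add_neg, ofReal_exp_add, lintegral_sampleLaw_prod hγ
    (measurable_likelihoodRatio hβ hγ).sqrt.ennreal_ofReal]
  gcongr
  calc _ ≤ (ENNReal.ofReal (Real.exp (-(probDist G β γ ^ 2 / 8)))) ^ n :=
        pow_le_pow_left₀ zero_le (lintegral_sqrt_likelihoodRatio_le hβ hγ) n
    _ = _ := by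
        rw [← ENNReal.ofReal_pow (Real.exp_pos _).le, ← Real.exp_nat_mul]; congr 2; ring

end sampleRatio

attribute [irreducible] sampleRatio

/-! ### Posterior bounds at a fixed sample size -/

/-- The Cauchy–Schwarz inequality for a function and its inverse. -/
lemma measure_sq_le_lintegral_mul_lintegral_inv {S : Type*} [MeasurableSpace S] (μ : Measure S)
    {f : S → ℝ≥0∞} (hf : Measurable f) (h0 : ∀ s, f s ≠ 0) (htop : ∀ s, f s ≠ ∞) (A : Set S) :
    μ A ^ 2 ≤ (∫⁻ s, f s ∂μ) * ∫⁻ s in A, (f s)⁻¹ ∂μ := by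
  have h := ENNReal.lintegral_mul_le_Lp_mul_Lq (μ.restrict A) Real.HolderConjugate.two_two
    (f := fun s => f s ^ (2⁻¹ : ℝ)) (g := fun s => (f s)⁻¹ ^ (2⁻¹ : ℝ))
    (hf.pow_const _).aemeasurable (hf.inv.pow_const _).aemeasurable
  have e1 : ∀ a : ℝ≥0∞, (a ^ (2⁻¹ : ℝ)) ^ (2 : ℝ) = a := fun a => by
    rw [← ENNReal.rpow_mul]; norm_num
  have e2 : ∀ s, ((fun s => f s ^ (2⁻¹ : ℝ)) * fun s => (f s)⁻¹ ^ (2⁻¹ : ℝ)) s = 1 := fun s => by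
    rw [Pi.mul_apply, ← ENNReal.mul_rpow_of_nonneg _ _ (by norm_num),
      ENNReal.mul_inv_cancel (h0 s) (htop s), ENNReal.one_rpow]
  simp only [e1, e2, lintegral_const, one_mul, Measure.restrict_apply_univ] at h
  rw [← ENNReal.mul_rpow_of_nonneg _ _ (by norm_num)] at h
  have h2 := ENNReal.rpow_le_rpow h (show (0 : ℝ) ≤ 2 by norm_num)
  rw [← ENNReal.rpow_mul] at h2
  norm_num at h2
  refine h2.trans (mul_le_mul_left (lintegral_mono' Measure.restrict_le_self le_rfl) _)

section posterior

variable {m n : ℕ} {S : Type*} [MeasurableSpace S] {b : S → Fin m → unitInterval → ℝ}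
  {γ : Fin m → unitInterval → ℝ} {G : Measure Covariate} [IsProbabilityMeasure G]
  {Pr : Measure S} [IsProbabilityMeasure Pr]

lemma measurable_sampleRatio_left (hmeas : Measurable
      fun q : S × (Fin n → Covariate × Fin (m + 1)) => sampleRatio (b q.1) γ q.2)
    (z : Fin n → Covariate × Fin (m + 1)) : Measurable fun s => sampleRatio (b s) γ z := by
  have h : Measurable fun s : S => (s, z) := measurable_prodMk_right
  exact hmeas.comp h

/-- The evidence is not small with large probability. -/
lemma sampleLaw_evidence_lt_le (hb : ∀ s l, BoundedMeasurable (b s l))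
    (hγ : ∀ l, BoundedMeasurable (γ l)) (hmeas : Measurable
      fun q : S × (Fin n → Covariate × Fin (m + 1)) => sampleRatio (b q.1) γ q.2)
    {A : Set S} {δ a c : ℝ} (hδ0 : 0 ≤ δ) (hδ : δ ≤ 1 / 2)
    (hA : ∀ s ∈ A, ∀ᵐ x ∂G, ∀ l, |linearPredictor (b s l) x - linearPredictor (γ l) x| ≤ δ)
    (ha : ENNReal.ofReal (Real.exp (-a)) ≤ Pr A) :
    sampleLaw G γ n {z | ∫⁻ s, sampleRatio (b s) γ z ∂Pr <
        ENNReal.ofReal (Real.exp (-(a + c)))} ≤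
      ENNReal.ofReal (Real.exp (16 * n * δ ^ 2 - c)) := by
  have := isProbabilityMeasure_sampleLaw (G := G) hγ n
  have hA0 : Pr A ≠ 0 := (lt_of_lt_of_le (ENNReal.ofReal_pos.2 (Real.exp_pos _)) ha).ne'
  have hAt : Pr A ≠ ∞ := measure_ne_top _ _
  -- If the evidence is below `exp (-c) * Pr A`, then Cauchy–Schwarz makes the integral of the
  -- inverse ratio over `A`, divided by `Pr A`, at least `exp c`. The mean of that average is at
  -- most `exp (16 n δ²)`.
  have hsub : {z | ∫⁻ s, sampleRatio (b s) γ z ∂Pr < ENNReal.ofReal (Real.exp (-(a + c)))} ⊆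
      {z | ENNReal.ofReal (Real.exp (-(-c))) ≤
        (Pr A)⁻¹ * ∫⁻ s in A, (sampleRatio (b s) γ z)⁻¹ ∂Pr} := fun z hz => by
    simp only [Set.mem_ofPred_eq] at hz ⊢
    have h1 := measure_sq_le_lintegral_mul_lintegral_inv Pr
      (measurable_sampleRatio_left hmeas z) (fun _ => sampleRatio_ne_zero)
      (fun _ => sampleRatio_ne_top) A
    have h2 : ∫⁻ s, sampleRatio (b s) γ z ∂Pr ≤ Pr A * ENNReal.ofReal (Real.exp (-c)) := by
      rw [neg_add, ofReal_exp_add] at hz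
      exact hz.le.trans (mul_le_mul_left ha _)
    set I := ∫⁻ s in A, (sampleRatio (b s) γ z)⁻¹ ∂Pr
    have h3 : Pr A * Pr A ≤ Pr A * (ENNReal.ofReal (Real.exp (-c)) * I) := by
      rw [← sq, ← mul_assoc]; exact h1.trans (mul_le_mul_left h2 _)
    have h4 := (ENNReal.mul_le_mul_iff_right hA0 hAt).1 h3
    rw [neg_neg, mul_comm _ I, ← div_eq_mul_inv, ENNReal.le_div_iff_mul_le (Or.inl hA0) (Or.inl hAt)]
    calc _ ≤ ENNReal.ofReal (Real.exp c) * (ENNReal.ofReal (Real.exp (-c)) * I) :=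
          mul_le_mul_right h4 _
      _ = I := by rw [← mul_assoc, ← ofReal_exp_add, add_neg_cancel]; simp
  have hinv : Measurable fun q : (Fin n → Covariate × Fin (m + 1)) × S =>
      (sampleRatio (b q.2) γ q.1)⁻¹ := (hmeas.comp measurable_swap).inv
  have hI : Measurable fun z => ∫⁻ s in A, (sampleRatio (b s) γ z)⁻¹ ∂Pr :=
    hinv.lintegral_prod_right'
  have hE : Measurable fun s => ∫⁻ z, (sampleRatio (b s) γ z)⁻¹ ∂(sampleLaw G γ n) :=
    hinv.lintegral_prod_left'
  refine (measure_mono hsub).trans ((measure_exp_neg_le_le _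
    (hI.const_mul _).aemeasurable _).trans ?_)
  rw [lintegral_const_mul _ hI, lintegral_lintegral_swap hinv.aemeasurable]
  have h5 : ∫⁻ s in A, ∫⁻ z, (sampleRatio (b s) γ z)⁻¹ ∂(sampleLaw G γ n) ∂Pr ≤
      ENNReal.ofReal (Real.exp (16 * n * δ ^ 2)) * Pr A := by
    calc _ ≤ ∫⁻ _ in A, ENNReal.ofReal (Real.exp (16 * n * δ ^ 2)) ∂Pr := by
          refine lintegral_mono_ae ((ae_restrict_iff (measurableSet_le hE measurable_const)).2
            (Eventually.of_forall fun s hs => ?_))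
          simp_rw [← sampleRatio_symm]
          exact lintegral_sampleRatio_symm_le (hb s) hγ hδ0 hδ (hA s hs)
      _ = _ := by simp
  calc _ ≤ ENNReal.ofReal (Real.exp (-c)) *
        ((Pr A)⁻¹ * (ENNReal.ofReal (Real.exp (16 * n * δ ^ 2)) * Pr A)) := by gcongr
    _ = _ := by
      rw [sub_eq_neg_add, ofReal_exp_add, mul_comm _ (Pr A), ← mul_assoc (Pr A)⁻¹,
        ENNReal.inv_mul_cancel hA0 hAt, one_mul]

/-- By Fubini the integral over `U` has mean `Pr U`, because every ratio has mean one under the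
truth. It handles the complement of the sieve. -/
lemma sampleLaw_lintegral_ge_le (hb : ∀ s l, BoundedMeasurable (b s l))
    (hγ : ∀ l, BoundedMeasurable (γ l)) (hmeas : Measurable
      fun q : S × (Fin n → Covariate × Fin (m + 1)) => sampleRatio (b q.1) γ q.2)
    (U : Set S) (v : ℝ) :
    sampleLaw G γ n {z | ENNReal.ofReal (Real.exp (-v)) ≤ ∫⁻ s in U, sampleRatio (b s) γ z ∂Pr} ≤
      ENNReal.ofReal (Real.exp v) * Pr U := by
  have := isProbabilityMeasure_sampleLaw (G := G) hγ n
  have hsw : Measurable fun q : (Fin n → Covariate × Fin (m + 1)) × S =>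
      sampleRatio (b q.2) γ q.1 := hmeas.comp measurable_swap
  have hI : Measurable fun z => ∫⁻ s in U, sampleRatio (b s) γ z ∂Pr :=
    hsw.lintegral_prod_right'
  refine (measure_exp_neg_le_le _ hI.aemeasurable _).trans (le_of_eq ?_)
  rw [lintegral_lintegral_swap hsw.aemeasurable]
  simp [lintegral_sampleRatio (hb _) hγ]

/-- The likelihood ratio is uniformly small over a set of parameters that are far away and that is
covered by finitely many cells on each of which the likelihood is nearly constant. -/
lemma sampleLaw_lintegral_cells_ge_le (hb : ∀ s l, BoundedMeasurable (b s l))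
    (hγ : ∀ l, BoundedMeasurable (γ l)) (hmeas : Measurable
      fun q : S × (Fin n → Covariate × Fin (m + 1)) => sampleRatio (b q.1) γ q.2)
    {R : ℝ} (hG : ∀ᵐ x ∂G, ‖x‖ ≤ R) {ι : Type*} [DecidableEq ι] (cell : S → ι) (F : Finset ι)
    {T : Set S} (hF : ∀ s ∈ T, cell s ∈ F) {η : ℝ} (hη : 0 ≤ η) (hnη : 2 * n * η ≤ 1)
    (hcell : ∀ s ∈ T, ∀ s' ∈ T, cell s = cell s' → ∀ x : Covariate, ‖x‖ ≤ R → ∀ l,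
      |linearPredictor (b s l) x - linearPredictor (b s' l) x| ≤ η)
    {r : ℝ} (hr0 : 0 ≤ r) (hr : ∀ s ∈ T, r ≤ probDist G (b s) γ) (v : ℝ) :
    sampleLaw G γ n {z | ENNReal.ofReal (Real.exp (-v)) ≤ ∫⁻ s in T, sampleRatio (b s) γ z ∂Pr} ≤
      F.card * ENNReal.ofReal (Real.exp ((v + 1) / 2 - n * r ^ 2 / 8)) := by
  classical
  rcases T.eq_empty_or_nonempty with rfl | ⟨s₀, hs₀⟩
  · have : {z : Fin n → Covariate × Fin (m + 1) | ENNReal.ofReal (Real.exp (-v)) ≤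
        ∫⁻ s in (∅ : Set S), sampleRatio (b s) γ z ∂Pr} = ∅ := by
      ext z; simp [Real.exp_pos]
    rw [this]; simp
  -- Empty cells receive the arbitrary point `s₀`, so that every representative lies in `T` and is
  -- far from the truth.
  obtain ⟨rep, hrep⟩ : ∃ rep : ι → S, ∀ i, rep i ∈ T ∧ (∀ s ∈ T, cell s = i → cell (rep i) = i) := by
    refine ⟨fun i => if h : ∃ s ∈ T, cell s = i then h.choose else s₀, fun i => ?_⟩
    dsimp only
    split_ifs with h
    · exact ⟨h.choose_spec.1, fun _ _ _ => h.choose_spec.2⟩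
    · exact ⟨hs₀, fun s hs hi => absurd ⟨s, hs, hi⟩ h⟩
  set Z := {z : Fin n → Covariate × Fin (m + 1) | ∀ i, ‖(z i).1‖ ≤ R} with hZ
  have hae : ∀ᵐ z ∂(sampleLaw G γ n), z ∈ Z := ae_sampleLaw_norm_le hγ hG
  have hsub : {z | ENNReal.ofReal (Real.exp (-v)) ≤ ∫⁻ s in T, sampleRatio (b s) γ z ∂Pr}
      ≤ᵐ[sampleLaw G γ n]
      (⋃ i ∈ F, {z | ENNReal.ofReal (Real.exp (-(v + 1))) ≤ sampleRatio (b (rep i)) γ z} :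
        Set (Fin n → Covariate × Fin (m + 1))) := by
    filter_upwards [hae] with z hz hle
    by_contra hcon
    have hlt : ∀ i ∈ F, sampleRatio (b (rep i)) γ z < ENNReal.ofReal (Real.exp (-(v + 1))) := by
      intro i hi
      by_contra h
      exact hcon (Set.mem_biUnion hi (not_lt.1 h))
    -- The largest ratio at a representative controls the integral over `T` up to the factor `exp
    -- 1`, since `2 n η ≤ 1` and the prior has total mass one. The `+ 1` in the threshold absorbs
    -- this factor.
    set c : ℝ≥0∞ := F.sup fun i => sampleRatio (b (rep i)) γ z with hc
    have hc1 : c < ENNReal.ofReal (Real.exp (-(v + 1))) :=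
      (Finset.sup_lt_iff (ENNReal.ofReal_pos.2 (Real.exp_pos _))).2 hlt
    have hT : ∀ s ∈ T, sampleRatio (b s) γ z ≤ ENNReal.ofReal (Real.exp 1) * c := by
      intro s hs
      obtain ⟨h1, h2⟩ := hrep (cell s)
      calc _ ≤ ENNReal.ofReal (Real.exp (2 * n * η)) * sampleRatio (b (rep (cell s))) γ z :=
            sampleRatio_le_exp_mul hη (hcell s hs _ h1 (h2 s hs rfl).symm) hz
        _ ≤ _ := by
            gcongr
            exact Finset.le_sup (f := fun i => sampleRatio (b (rep i)) γ z) (hF s hs)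
    have h3 : ∫⁻ s in T, sampleRatio (b s) γ z ∂Pr ≤ ENNReal.ofReal (Real.exp 1) * c := by
      calc _ ≤ ∫⁻ _ in T, ENNReal.ofReal (Real.exp 1) * c ∂Pr :=
            lintegral_mono_ae ((ae_restrict_iff (measurableSet_le
              (measurable_sampleRatio_left hmeas z) measurable_const)).2
              (Eventually.of_forall hT))
        _ ≤ _ := by
            simp only [lintegral_const, Measure.restrict_apply_univ]
            exact mul_le_of_le_one_right' prob_le_one
    have h4 : ENNReal.ofReal (Real.exp 1) * c < ENNReal.ofReal (Real.exp (-v)) := by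
      have e : -v = 1 + -(v + 1) := by ring
      rw [e, ofReal_exp_add]
      exact ENNReal.mul_lt_mul_right (ENNReal.ofReal_pos.2 (Real.exp_pos _)).ne'
        ENNReal.ofReal_ne_top hc1
    exact absurd (lt_of_le_of_lt h3 h4) (not_lt.2 hle)
  refine (measure_mono_ae hsub).trans ((measure_biUnion_finset_le _ _).trans ?_)
  rw [← nsmul_eq_mul]
  refine Finset.sum_le_card_nsmul _ _ _ fun i _ => ?_
  refine (sampleLaw_exp_neg_le_sampleRatio_le (hb _) hγ _).trans
    (ENNReal.ofReal_le_ofReal (Real.exp_le_exp.2 ?_))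
  have := pow_le_pow_left₀ hr0 (hr _ (hrep i).1) 2
  have := mul_le_mul_of_nonneg_left this (Nat.cast_nonneg (α := ℝ) n)
  linarith

end posterior

/-- A bound on the probability that the posterior mass of `B` is not small. -/
theorem sampleLaw_posterior_ge_le {m n : ℕ} {ψ : (J : ℕ) → Fin J → unitInterval → ℝ}
    {γ : Fin m → unitInterval → ℝ} {G : Measure Covariate} [IsProbabilityMeasure G]
    {Pr : Measure (SeriesParam m)} [IsProbabilityMeasure Pr]
    (hb : ∀ (s : SeriesParam m) l, BoundedMeasurable (s.coeff ψ l))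
    (hγ : ∀ l, BoundedMeasurable (γ l)) (hmeas : Measurable
      fun q : SeriesParam m × (Fin n → Covariate × Fin (m + 1)) =>
        sampleRatio (q.1.coeff ψ) γ q.2)
    {R : ℝ} (hG : ∀ᵐ x ∂G, ‖x‖ ≤ R) {ι : Type*} [DecidableEq ι] (cell : SeriesParam m → ι)
    (F : Finset ι) {A B V : Set (SeriesParam m)} (hF : ∀ s ∈ V, cell s ∈ F)
    {η : ℝ} (hη : 0 ≤ η) (hnη : 2 * n * η ≤ 1)
    (hcell : ∀ s ∈ V, ∀ s' ∈ V, cell s = cell s' → ∀ x : Covariate, ‖x‖ ≤ R → ∀ l,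
      |linearPredictor (s.coeff ψ l) x - linearPredictor (s'.coeff ψ l) x| ≤ η)
    {r : ℝ} (hr0 : 0 ≤ r) (hr : ∀ s ∈ B, r ≤ probDist G (s.coeff ψ) γ)
    {δ a : ℝ} (hδ0 : 0 ≤ δ) (hδ : δ ≤ 1 / 2)
    (hA : ∀ s ∈ A, ∀ᵐ x ∂G, ∀ l,
      |linearPredictor (s.coeff ψ l) x - linearPredictor (γ l) x| ≤ δ)
    (ha : ENNReal.ofReal (Real.exp (-a)) ≤ Pr A) (c τ : ℝ) :
    sampleLaw G γ n {z | ENNReal.ofReal (Real.exp (-τ)) ≤ posterior ψ Pr z B} ≤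
      ENNReal.ofReal (Real.exp (16 * n * δ ^ 2 - c)) +
      (ENNReal.ofReal (Real.exp (a + c + τ + 1)) * Pr Vᶜ +
      F.card * ENNReal.ofReal (Real.exp ((a + c + τ + 1 + 1) / 2 - n * r ^ 2 / 8))) := by
  set v := a + c + τ + 1 with hv
  -- When the evidence is at least `exp (-(a + c))`, the numerator is at least `exp (-(a + c + τ)) =
  -- exp 1 * exp (-v) ≥ 2 * exp (-v)`, so one of its two pieces is at least `exp (-v)`.
  have hsub : {z | ENNReal.ofReal (Real.exp (-τ)) ≤ posterior ψ Pr z B} ⊆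
      {z | ∫⁻ s, sampleRatio (s.coeff ψ) γ z ∂Pr < ENNReal.ofReal (Real.exp (-(a + c)))} ∪
      ({z | ENNReal.ofReal (Real.exp (-v)) ≤ ∫⁻ s in Vᶜ, sampleRatio (s.coeff ψ) γ z ∂Pr} ∪
      {z : Fin n → Covariate × Fin (m + 1) | ENNReal.ofReal (Real.exp (-v)) ≤
        ∫⁻ s in B ∩ V, sampleRatio (s.coeff ψ) γ z ∂Pr}) := by
    intro z hz
    simp only [Set.mem_union, Set.mem_ofPred_eq] at hz ⊢
    by_contra! hcon
    obtain ⟨h1, h2, h3⟩ := hcon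
    have hms := measurable_sampleRatio_left hmeas z
    have hpost : posterior ψ Pr z B = (∫⁻ s in B, sampleRatio (s.coeff ψ) γ z ∂Pr) /
        ∫⁻ s, sampleRatio (s.coeff ψ) γ z ∂Pr := by
      have hl : ∀ s : SeriesParam m, likelihood (s.coeff ψ) z =
          likelihood γ z * sampleRatio (s.coeff ψ) γ z := fun s => likelihood_eq_mul_sampleRatio
      rw [posterior]
      simp_rw [hl]
      rw [lintegral_const_mul _ hms, lintegral_const_mul _ hms]
      exact ENNReal.mul_div_mul_left _ _ likelihood_ne_zero likelihood_ne_top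
    rw [hpost] at hz
    have h4 : ENNReal.ofReal (Real.exp (-τ)) * ENNReal.ofReal (Real.exp (-(a + c))) ≤
        ∫⁻ s in B, sampleRatio (s.coeff ψ) γ z ∂Pr :=
      (mul_le_mul_right h1 _).trans (ENNReal.mul_le_of_le_div hz)
    have h5 : ∫⁻ s in B, sampleRatio (s.coeff ψ) γ z ∂Pr ≤
        ∫⁻ s in Vᶜ, sampleRatio (s.coeff ψ) γ z ∂Pr +
          ∫⁻ s in B ∩ V, sampleRatio (s.coeff ψ) γ z ∂Pr :=
      (lintegral_mono_set fun s hs => by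
        by_cases h : s ∈ V
        · exact Or.inr ⟨hs, h⟩
        · exact Or.inl h).trans (lintegral_union_le _ _ _)
    have h6 := (h4.trans h5).trans_lt (ENNReal.add_lt_add h2 h3)
    rw [← ofReal_exp_add, ← two_mul] at h6
    have h7 : (2 : ℝ≥0∞) * ENNReal.ofReal (Real.exp (-v)) ≤
        ENNReal.ofReal (Real.exp (-τ + -(a + c))) := by
      have e : -τ + -(a + c) = 1 + -v := by rw [hv]; ring
      rw [e, ofReal_exp_add]
      gcongr
      rw [show (2 : ℝ≥0∞) = ENNReal.ofReal 2 by simp]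
      exact ENNReal.ofReal_le_ofReal (by linarith [Real.add_one_le_exp 1])
    exact absurd h6 (not_lt.2 h7)
  refine (measure_mono hsub).trans ((measure_union_le _ _).trans (add_le_add ?_
    ((measure_union_le _ _).trans (add_le_add ?_ ?_))))
  · exact sampleLaw_evidence_lt_le hb hγ hmeas hδ0 hδ hA ha
  · exact sampleLaw_lintegral_ge_le hb hγ hmeas _ _
  · exact sampleLaw_lintegral_cells_ge_le hb hγ hmeas hG cell F (fun s hs => hF s hs.2) hη hnη
      (fun s hs s' hs' => hcell s hs.2 s' hs'.2) hr0 (fun s hs => hr s hs.1) v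

/-! ### Measurability on a countable disjoint union -/

lemma measurableEmbedding_sigmaMk {ι : Type*} {E : ι → Type*} [∀ i, MeasurableSpace (E i)]
    (i : ι) : MeasurableEmbedding (Sigma.mk i : E i → Σ i, E i) where
  injective := sigma_mk_injective
  measurable := measurable_iff_le_map.2 (iInf_le _ i)
  measurableSet_image' := fun {s} hs => by
    refine MeasurableSpace.measurableSet_iInf.2 fun j => ?_
    change MeasurableSet (Sigma.mk j ⁻¹' (Sigma.mk i '' s))
    by_cases h : i = j
    · subst h
      rwa [sigma_mk_preimage_image_eq_self]
    · rw [sigma_mk_preimage_image' h]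
      exact MeasurableSet.empty

lemma measurable_sigma_prod {ι : Type*} [Countable ι] {E : ι → Type*}
    [∀ i, MeasurableSpace (E i)] {Z Y : Type*} [MeasurableSpace Z] [MeasurableSpace Y]
    {f : (Σ i, E i) × Z → Y} (h : ∀ i, Measurable fun q : E i × Z => f (⟨i, q.1⟩, q.2)) :
    Measurable f := fun s hs => by
  have : f ⁻¹' s = ⋃ i, Prod.map (Sigma.mk i) id ''
      ((fun q : E i × Z => f (⟨i, q.1⟩, q.2)) ⁻¹' s) := by
    ext ⟨⟨i, e⟩, z⟩
    simp only [Set.mem_preimage, Set.mem_iUnion, Set.mem_image, Prod.exists]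
    constructor
    · exact fun h => ⟨i, e, z, h, rfl⟩
    · rintro ⟨j, a, w, hw, heq⟩
      simp only [Prod.map_apply, id_eq] at heq
      rwa [heq] at hw
  rw [this]
  exact MeasurableSet.iUnion fun i =>
    ((measurableEmbedding_sigmaMk i).prodMap MeasurableEmbedding.id).measurableSet_image.2 (h i hs)

/-! ### Coefficient priors and finite series -/

/-- Small balls around every point of the cube `[-H, H]^J` have prior mass at least
`exp (-c J log (1/ε))`. -/
def CoefficientMassCondition (Q : (J : ℕ) → Measure (EuclideanSpace ℝ (Fin J))) (H : ℝ) : Prop :=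
  ∃ c > (0 : ℝ), ∃ ε₀ > (0 : ℝ), ∃ b ≥ (0 : ℝ), ∀ J : ℕ, 1 ≤ J →
    ∀ θ₀ : EuclideanSpace ℝ (Fin J), (∀ j, |θ₀ j| ≤ H) →
    ∀ ε : ℝ, 0 < ε → ε ≤ ε₀ * (J : ℝ) ^ (-b) →
      Real.exp (-c * J * Real.log (1 / ε)) ≤ (Q J).real {θ | ‖θ - θ₀‖ ≤ ε}

/-- The complement of `[-M, M]^J` has prior mass at most `J exp (-C M^t)` for large `M`, where the
exponent `t` is any positive real number. -/
def CoefficientTailCondition (Q : (J : ℕ) → Measure (EuclideanSpace ℝ (Fin J))) : Prop :=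
  ∃ C > (0 : ℝ), ∃ t > (0 : ℝ), ∀ᶠ M : ℝ in atTop, ∀ J : ℕ, 1 ≤ J →
    (Q J).real {θ | ¬ ∀ j, θ j ∈ Set.Icc (-M) M} ≤ J * Real.exp (-C * M ^ t)

section series

variable {ψ : (J : ℕ) → Fin J → unitInterval → ℝ} {K₀ : ℝ}

lemma boundedMeasurable_series (hψ : ∀ J j, Measurable (ψ J j)) (hbasis : BasisLipschitzCondition ψ K₀)
    {J : ℕ} (θ : EuclideanSpace ℝ (Fin J)) : BoundedMeasurable (series (ψ J) θ) := by
  refine ⟨Finset.measurable_fun_sum _ fun j _ => (hψ J j).const_mul _, ?_⟩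
  rcases Nat.eq_zero_or_pos J with rfl | hJ
  · exact ⟨0, fun t => by simp [series]⟩
  · obtain ⟨C, -, hC⟩ := hbasis
    refine ⟨C * (J : ℝ) ^ K₀ * ‖θ - 0‖, fun t => ?_⟩
    simpa [series] using hC J hJ θ 0 t

lemma boundedMeasurable_basis (hψ : ∀ J j, Measurable (ψ J j)) (hbasis : BasisLipschitzCondition ψ K₀)
    {J : ℕ} (j : Fin J) : BoundedMeasurable (ψ J j) := by
  have h : series (ψ J) (EuclideanSpace.single j 1) = ψ J j := by
    ext t
    simp [series]
  exact h ▸ boundedMeasurable_series hψ hbasis _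

/-- Separates parameter and covariate: a finite sum of coordinates of `θ` times continuous
functionals of `x`. Joint measurability of the likelihood ratio follows from this. -/
lemma linearPredictor_series (hψ : ∀ J j, Measurable (ψ J j)) (hbasis : BasisLipschitzCondition ψ K₀)
    {J : ℕ} (θ : EuclideanSpace ℝ (Fin J)) (x : Covariate) :
    linearPredictor (series (ψ J) θ) x = ∑ j, θ j * linearPredictor (ψ J j) x := by
  simp only [linearPredictor, series, Finset.sum_mul, mul_assoc]
  rw [integral_finsetSum _ fun j _ =>
    ((boundedMeasurable_basis hψ hbasis j).integrable_mul x).const_mul _]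
  simp only [integral_const_mul]

lemma measurable_sampleRatio_coeff {m n : ℕ} (hψ : ∀ J j, Measurable (ψ J j))
    (hbasis : BasisLipschitzCondition ψ K₀) {γ : Fin m → unitInterval → ℝ}
    (hγ : ∀ l, BoundedMeasurable (γ l)) : Measurable
      fun q : SeriesParam m × (Fin n → Covariate × Fin (m + 1)) =>
        sampleRatio (q.1.coeff ψ) γ q.2 := by
  refine measurable_sigma_prod fun J => ?_
  unfold sampleRatio
  refine Finset.measurable_fun_prod _ fun i _ => ?_
  have hx : Measurable fun q : ((Fin m → EuclideanSpace ℝ (Fin J)) × Covariate) × Fin (m + 1) =>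
      categoryProb (SeriesParam.coeff ψ ⟨J, q.1.1⟩) q.1.2 q.2 := by
    refine measurable_from_prod_countable_left fun k =>
      measurable_categoryProb_of (b := fun q : (Fin m → EuclideanSpace ℝ (Fin J)) × Covariate =>
        SeriesParam.coeff ψ ⟨J, q.1⟩) (X := Prod.snd) (fun l => ?_) k
    simp only [SeriesParam.coeff, linearPredictor_series hψ hbasis]
    refine Finset.measurable_fun_sum _ fun j _ => Measurable.mul ?_
      ((boundedMeasurable_basis hψ hbasis j).continuous_linearPredictor.measurable.comp
        measurable_snd)
    have h1 : Measurable fun q : (Fin m → EuclideanSpace ℝ (Fin J)) × Covariate => q.1 l :=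
      (measurable_pi_apply l).comp measurable_fst
    exact (by fun_prop : Measurable fun v : EuclideanSpace ℝ (Fin J) => v j).comp h1
  have hz : Measurable fun q : (Fin m → EuclideanSpace ℝ (Fin J)) ×
      (Fin n → Covariate × Fin (m + 1)) => ((q.1, (q.2 i).1), (q.2 i).2) := by
    have h2 : Measurable fun q : (Fin m → EuclideanSpace ℝ (Fin J)) ×
      (Fin n → Covariate × Fin (m + 1)) => q.2 i := (measurable_pi_apply i).comp measurable_snd
    exact (measurable_fst.prodMk h2.fst).prodMk h2.snd
  have h3 : Measurable fun q : (Fin m → EuclideanSpace ℝ (Fin J)) ×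
      (Fin n → Covariate × Fin (m + 1)) => likelihoodRatio (SeriesParam.coeff ψ ⟨J, q.1⟩) γ (q.2 i) :=
    (hx.comp hz).div ((measurable_categoryProb_uncurry hγ).comp
      ((measurable_pi_apply i).comp measurable_snd))
  exact h3.ennreal_ofReal

/-- The true coefficient function is a uniform limit of bounded measurable series, so its regularity
need not be assumed separately. -/
lemma ApproximationCondition.boundedMeasurable {β : unitInterval → ℝ} {H α : ℝ} (hα : 0 < α)
    (hψ : ∀ J j, Measurable (ψ J j)) (hbasis : BasisLipschitzCondition ψ K₀)
    (h : ApproximationCondition ψ β H α) : BoundedMeasurable β := by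
  obtain ⟨C, -, h⟩ := h
  choose θ _ hθ using h
  constructor
  · refine measurable_of_tendsto_metrizable (f := fun n : ℕ => series (ψ (n + 1)) (θ (n + 1) (Nat.le_add_left 1 n)))
      (fun n => (boundedMeasurable_series hψ hbasis _).1) (tendsto_pi_nhds.2 fun t => ?_)
    have hlim : Tendsto (fun n : ℕ => C * ((n + 1 : ℕ) : ℝ) ^ (-α)) atTop (𝓝 0) := by
      have := ((tendsto_rpow_neg_atTop hα).comp
        (tendsto_natCast_atTop_atTop.comp (tendsto_add_atTop_nat 1))).const_mul C
      simpa using this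
    refine tendsto_iff_dist_tendsto_zero.2 (squeeze_zero (fun _ => dist_nonneg) (fun n => ?_) hlim)
    rw [dist_comm]
    exact hθ (n + 1) (by omega) t
  · obtain ⟨B, hB⟩ := (boundedMeasurable_series hψ hbasis (θ 1 le_rfl)).2
    refine ⟨C * ((1 : ℕ) : ℝ) ^ (-α) + B, fun t => ?_⟩
    have h1 := hθ 1 le_rfl t
    have h2 := hB t
    have := abs_sub_abs_le_abs_sub (β t) (series (ψ 1) (θ 1 le_rfl) t)
    linarith

/-- The prior of a coefficient vector puts enough mass near approximations of the truth. -/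
lemma exists_coefficient_mass {Q : (J : ℕ) → Measure (EuclideanSpace ℝ (Fin J))}
    [∀ J, IsProbabilityMeasure (Q J)] {β : unitInterval → ℝ} {H α : ℝ} (hα : 0 < α) (hK₀ : 0 ≤ K₀)
    (hQ : CoefficientMassCondition Q H) (happrox : ApproximationCondition ψ β H α)
    (hbasis : BasisLipschitzCondition ψ K₀) :
    ∃ C > 0, ∀ᶠ j : ℕ in atTop, ∃ A : Set (EuclideanSpace ℝ (Fin j)),
      ENNReal.ofReal (Real.exp (-(C * j * Real.log j))) ≤ Q j A ∧
      ∀ θ ∈ A, ∀ t, |series (ψ j) θ t - β t| ≤ C * (j : ℝ) ^ (-α) := by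
  obtain ⟨c, hc, ε₀, hε₀, b, hb, hQ⟩ := hQ
  obtain ⟨C₁, hC₁, happrox⟩ := happrox
  obtain ⟨C₂, hC₂, hbasis⟩ := hbasis
  set e := min ε₀ 1 with he
  have he0 : 0 < e := lt_min hε₀ one_pos
  have he1 : e ≤ 1 := min_le_right _ _
  have hle : 0 ≤ -Real.log e := neg_nonneg.2 (Real.log_nonpos he0.le he1)
  -- The radius `e * j^(-u)` meets the threshold `ε₀ * j^(-b)` and, after the Lipschitz factor
  -- `j^K₀`, leaves an error of order `j^(-α)`. Being polynomial in `j`, it costs only `j log j` in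
  -- the mass exponent.
  set u := K₀ + α + b with hu
  have hu0 : 0 < u := by positivity
  refine ⟨max (c * (u - Real.log e)) (C₁ + C₂), lt_max_of_lt_right (by positivity), ?_⟩
  filter_upwards [eventually_ge_atTop 1, (Real.tendsto_log_atTop.comp
    tendsto_natCast_atTop_atTop).eventually_ge_atTop 1] with j hj hlog
  simp only [Function.comp_apply] at hlog
  have hj1 : (1 : ℝ) ≤ j := by exact_mod_cast hj
  have hj0 : (0 : ℝ) < j := by linarith
  obtain ⟨θ₀, hθ₀, happ⟩ := happrox j hj
  set ρ := e * (j : ℝ) ^ (-u) with hρ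
  have hρ0 : 0 < ρ := by positivity
  refine ⟨{θ | ‖θ - θ₀‖ ≤ ρ}, ?_, fun θ hθ t => ?_⟩
  · have h1 := hQ j hj θ₀ hθ₀ ρ hρ0 (mul_le_mul (min_le_left _ _)
      (Real.rpow_le_rpow_of_exponent_le hj1 (by linarith)) (by positivity) hε₀.le)
    rw [← ofReal_measureReal]
    refine ENNReal.ofReal_le_ofReal (le_trans (Real.exp_le_exp.2 ?_) h1)
    have h2 : Real.log (1 / ρ) ≤ (u - Real.log e) * Real.log j := by
      rw [one_div, Real.log_inv, hρ, Real.log_mul he0.ne' (by positivity), Real.log_rpow hj0]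
      nlinarith
    have h3 := le_max_left (c * (u - Real.log e)) (C₁ + C₂)
    calc _ ≤ -(c * (u - Real.log e) * j * Real.log j) := by gcongr
      _ = -(c * j * ((u - Real.log e) * Real.log j)) := by ring
      _ ≤ -(c * j * Real.log (1 / ρ)) := by gcongr
      _ = _ := by ring
  · have h1 := hbasis j hj θ θ₀ t
    have h2 := happ t
    rw [abs_sub_comm] at h2
    have h3 : C₂ * (j : ℝ) ^ K₀ * ‖θ - θ₀‖ ≤ C₂ * (j : ℝ) ^ (-α) := by
      calc _ ≤ C₂ * (j : ℝ) ^ K₀ * ρ := by gcongr; exact hθ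
        _ ≤ C₂ * (j : ℝ) ^ K₀ * (1 * (j : ℝ) ^ (-(K₀ + α))) := by
            rw [hρ]
            gcongr ?_ * ?_
            refine mul_le_mul he1 (Real.rpow_le_rpow_of_exponent_le hj1 (by linarith)) (by positivity) zero_le_one
        _ = _ := by
            rw [one_mul, mul_assoc, ← Real.rpow_add hj0]; congr 2; ring
    calc _ ≤ |series (ψ j) θ t - series (ψ j) θ₀ t| + |series (ψ j) θ₀ t - β t| :=
          abs_sub_le _ _ _
      _ ≤ (C₁ + C₂) * (j : ℝ) ^ (-α) := by linarith
      _ ≤ _ := by gcongr; exact le_max_right _ _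

end series

/-- If `q * t ≥ 2`, then `C * n^(q t) ≥ C * n² ≥ n` for large `n`. All larger `q` work too, so
finitely many coefficient vectors can share one power. -/
lemma exists_pow_tail_le {Q : (J : ℕ) → Measure (EuclideanSpace ℝ (Fin J))}
    [∀ J, IsProbabilityMeasure (Q J)] (hQ : CoefficientTailCondition Q) :
    ∃ q₀ : ℕ, ∀ q ≥ q₀, ∀ᶠ n : ℕ in atTop, ∀ J : ℕ, 1 ≤ J →
      Q J {θ | ¬ ∀ j, θ j ∈ Set.Icc (-(n : ℝ) ^ q) ((n : ℝ) ^ q)} ≤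
        ENNReal.ofReal (J * Real.exp (-n)) := by
  obtain ⟨C, hC, t, ht, hQ⟩ := hQ
  refine ⟨⌈2 / t⌉₊ + 1, fun q hq => ?_⟩
  have hqt : 2 ≤ q * t := by
    have h1 : 2 / t ≤ q := (Nat.le_ceil _).trans (by norm_cast; omega)
    rwa [div_le_iff₀ ht] at h1
  have hlim : Tendsto (fun n : ℕ => (n : ℝ) ^ q) atTop atTop :=
    (tendsto_pow_atTop (by omega)).comp tendsto_natCast_atTop_atTop
  filter_upwards [hlim.eventually hQ, eventually_ge_atTop 1,
    tendsto_natCast_atTop_atTop.eventually_ge_atTop (1 / C)] with n hn hn1 hnC J hJ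
  have hn1' : (1 : ℝ) ≤ n := by exact_mod_cast hn1
  rw [← ofReal_measureReal]
  refine ENNReal.ofReal_le_ofReal ((hn J hJ).trans ?_)
  gcongr
  rw [← Real.rpow_natCast, ← Real.rpow_mul (by positivity), neg_mul]
  refine neg_le_neg ?_
  calc (n : ℝ) ≤ C * n * n := by
        rw [div_le_iff₀ hC] at hnC
        nlinarith
    _ = C * (n : ℝ) ^ (2 : ℝ) := by rw [Real.rpow_two]; ring
    _ ≤ _ := by gcongr

/-! ### Prior mass near the truth and off the sieve -/

section prior

variable {m : ℕ} {p : PMF ℕ} {Q : (J : ℕ) → Fin m → Measure (EuclideanSpace ℝ (Fin J))}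

/-- Holds for arbitrary sets: the sum is countable and each inclusion of a fibre is a measurable
embedding. -/
lemma seriesPrior_apply (U : Set (SeriesParam m)) :
    seriesPrior p Q U = ∑' J, p J * Measure.pi (Q J) {θ | (⟨J, θ⟩ : SeriesParam m) ∈ U} := by
  simp only [seriesPrior, Measure.sum_apply_of_countable, Measure.smul_apply, smul_eq_mul]
  exact tsum_congr fun J => congrArg _ ((measurableEmbedding_sigmaMk
    (E := fun J => Fin m → EuclideanSpace ℝ (Fin J)) J).map_apply _ _)

variable [∀ J k, IsProbabilityMeasure (Q J k)]

instance isProbabilityMeasure_seriesPrior : IsProbabilityMeasure (seriesPrior p Q) := by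
  constructor
  rw [seriesPrior_apply]
  simp

lemma mul_prod_le_seriesPrior (j : ℕ) (A : Fin m → Set (EuclideanSpace ℝ (Fin j))) :
    p j * ∏ k, Q j k (A k) ≤ seriesPrior p Q (Sigma.mk j '' Set.univ.pi A) := by
  rw [seriesPrior_apply]
  refine le_trans (le_of_eq ?_) (ENNReal.le_tsum j)
  rw [← Measure.pi_pi]
  congr 2
  exact (sigma_mk_preimage_image_eq_self
    (β := fun J => Fin m → EuclideanSpace ℝ (Fin J))).symm

/-- The prior puts enough mass near approximations of the true coefficient functions. -/
lemma exists_prior_mass {ψ : (J : ℕ) → Fin J → unitInterval → ℝ} {K₀ t₁ t₂ H α : ℝ}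
    {β₀ : Fin m → unitInterval → ℝ} (hα : 0 < α) (hK₀ : 0 ≤ K₀)
    (hp : DimensionPriorCondition p t₁ t₂)
    (hQ : ∀ k, CoefficientMassCondition (fun J => Q J k) H)
    (happrox : ∀ k, ApproximationCondition ψ (β₀ k) H α)
    (hbasis : BasisLipschitzCondition ψ K₀) :
    ∃ C > 0, ∀ᶠ j : ℕ in atTop, ∃ A : Set (SeriesParam m),
      ENNReal.ofReal (Real.exp (-(C * j * Real.log j))) ≤ seriesPrior p Q A ∧
      ∀ s ∈ A, ∀ l t, |s.coeff ψ l t - β₀ l t| ≤ C * (j : ℝ) ^ (-α) := by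
  obtain ⟨-, -, ht₁, c₁, hc₁, c₂, -, hp⟩ := hp
  choose C hC h using fun k => exists_coefficient_mass hα hK₀ (hQ k) (happrox k) hbasis
  have hs : ∀ k, C k ≤ c₁ + ∑ k, C k := fun k =>
    (Finset.single_le_sum (fun i _ => (hC i).le) (Finset.mem_univ k)).trans (by linarith)
  have hs0 : 0 ≤ ∑ k, C k := Finset.sum_nonneg fun k _ => (hC k).le
  refine ⟨c₁ + ∑ k, C k, by positivity, ?_⟩
  filter_upwards [hp, eventually_all.2 h, (Real.tendsto_log_atTop.comp
    tendsto_natCast_atTop_atTop).eventually_ge_atTop 1] with j hpj hj hlog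
  simp only [Function.comp_apply] at hlog
  choose A hA hA' using hj
  refine ⟨Sigma.mk j '' Set.univ.pi A, ?_, ?_⟩
  · refine le_trans ?_ (mul_prod_le_seriesPrior j A)
    have h1 : ENNReal.ofReal (Real.exp (-(c₁ * j * Real.log j))) ≤ p j := by
      rw [← ENNReal.ofReal_toReal (p.apply_ne_top j)]
      refine ENNReal.ofReal_le_ofReal (le_trans (Real.exp_le_exp.2 ?_) hpj.1)
      have : Real.log j ^ t₁ ≤ Real.log j := by
        simpa using Real.rpow_le_rpow_of_exponent_le hlog ht₁
      have := mul_le_mul_of_nonneg_left this (by positivity : 0 ≤ c₁ * (j : ℝ))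
      linarith
    have h2 : ENNReal.ofReal (Real.exp (-((∑ k, C k) * j * Real.log j))) ≤ ∏ k, Q j k (A k) := by
      refine le_trans (le_of_eq ?_) (Finset.prod_le_prod' fun k _ => hA k)
      rw [← ENNReal.ofReal_prod_of_nonneg fun k _ => (Real.exp_pos _).le, ← Real.exp_sum,
        Finset.sum_neg_distrib, ← Finset.sum_mul, ← Finset.sum_mul]
    calc _ = ENNReal.ofReal (Real.exp (-(c₁ * j * Real.log j))) *
          ENNReal.ofReal (Real.exp (-((∑ k, C k) * j * Real.log j))) := by
          rw [← ofReal_exp_add]; congr 2; ring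
      _ ≤ _ := mul_le_mul' h1 h2
  · rintro _ ⟨θ, hθ, rfl⟩ l t
    refine (hA' l (θ l) (hθ l (Set.mem_univ _)) t).trans ?_
    gcongr
    exact hs l

/-- Parameters with at most `N` basis functions and coefficients in `[-B, B]`. -/
def sieve (m N : ℕ) (B : ℝ) : Set (SeriesParam m) :=
  {s | s.1 ≤ N ∧ ∀ k j, s.2 k j ∈ Set.Icc (-B) B}

lemma pi_preimage_sieve_compl_le {N J : ℕ} {B : ℝ} {e : ℝ≥0∞} (hJ : J ≤ N)
    (h : ∀ k, Q J k {θ | ¬ ∀ j, θ j ∈ Set.Icc (-B) B} ≤ e) :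
    Measure.pi (Q J) {θ | (⟨J, θ⟩ : SeriesParam m) ∈ (sieve m N B)ᶜ} ≤ m * e := by
  have hmeas : MeasurableSet {θ : EuclideanSpace ℝ (Fin J) | ¬ ∀ j, θ j ∈ Set.Icc (-B) B} := by
    have : MeasurableSet {θ : EuclideanSpace ℝ (Fin J) | ∀ j, θ j ∈ Set.Icc (-B) B} := by
      simp only [Set.ofPred_forall]
      exact MeasurableSet.iInter fun j =>
        (by fun_prop : Measurable fun v : EuclideanSpace ℝ (Fin J) => v j) measurableSet_Icc
    exact this.compl
  have hsub : {θ | (⟨J, θ⟩ : SeriesParam m) ∈ (sieve m N B)ᶜ} ⊆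
      ⋃ k, Function.eval k ⁻¹' {θ : EuclideanSpace ℝ (Fin J) | ¬ ∀ j, θ j ∈ Set.Icc (-B) B} := by
    intro θ hθ
    simp only [sieve, Set.mem_compl_iff, Set.mem_ofPred_eq, not_and] at hθ
    have := hθ hJ
    simp only [Set.mem_iUnion, Set.mem_preimage, Function.eval, Set.mem_ofPred_eq]
    by_contra! hcon
    exact this hcon
  refine (measure_mono hsub).trans ((measure_iUnion_fintype_le _ _).trans ?_)
  calc _ ≤ ∑ _k : Fin m, e := Finset.sum_le_sum fun k _ => by
        rw [(measurePreserving_eval (Q J) k).measure_preimage hmeas.nullMeasurableSet]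
        exact h k
    _ = _ := by simp

/-- Dimensions up to `N` contribute the coefficient tails, by a union bound over the `m` vectors.
For `J > N` the exponent `c J lam` is split in halves: one is at least `c/2 * N * lam`, the other at
least `c/2 * J`, which sums as a geometric series. -/
lemma seriesPrior_sieve_compl_le {N : ℕ} {B c lam : ℝ} {e : ℝ≥0∞} (hc : 0 < c) (hlam : 1 ≤ lam)
    (hQ : ∀ J, 1 ≤ J → J ≤ N → ∀ k, Q J k {θ | ¬ ∀ j, θ j ∈ Set.Icc (-B) B} ≤ e)
    (hp : ∀ J, N < J → (p J).toReal ≤ Real.exp (-c * J * lam)) :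
    seriesPrior p Q (sieve m N B)ᶜ ≤ m * e + ENNReal.ofReal (Real.exp (-(c / 2 * N * lam))) *
      (1 - ENNReal.ofReal (Real.exp (-(c / 2))))⁻¹ := by
  rw [seriesPrior_apply]
  have hterm : ∀ J, p J * Measure.pi (Q J) {θ | (⟨J, θ⟩ : SeriesParam m) ∈ (sieve m N B)ᶜ} ≤
      p J * (m * e) + ENNReal.ofReal (Real.exp (-(c / 2 * N * lam))) *
        ENNReal.ofReal (Real.exp (-(c / 2))) ^ J := fun J => by
    rcases le_or_gt J N with hJ | hJ
    · refine le_add_right (mul_le_mul_right (pi_preimage_sieve_compl_le hJ fun k => ?_) _)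
      -- In dimension zero there are no coefficients, so the bad set is empty; the hypothesis speaks
      -- only of `1 ≤ J`.
      rcases Nat.eq_zero_or_pos J with rfl | hJ0
      · simp
      · exact hQ J hJ0 hJ k
    · refine le_add_left ?_
      calc _ ≤ p J * 1 := mul_le_mul_right prob_le_one _
        _ = ENNReal.ofReal (p J).toReal := by rw [mul_one, ENNReal.ofReal_toReal (p.apply_ne_top J)]
        _ ≤ ENNReal.ofReal (Real.exp (-(c / 2 * N * lam) + J * -(c / 2))) := by
            refine ENNReal.ofReal_le_ofReal ((hp J hJ).trans (Real.exp_le_exp.2 ?_))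
            have h1 : (N : ℝ) ≤ J := by exact_mod_cast hJ.le
            have h2 : c / 2 * N * lam ≤ c / 2 * J * lam := by gcongr
            have h3 : c / 2 * J * 1 ≤ c / 2 * J * lam := by gcongr
            linarith
        _ = _ := by
            rw [ofReal_exp_add, Real.exp_nat_mul, ENNReal.ofReal_pow (Real.exp_pos _).le]
  refine (ENNReal.tsum_le_tsum hterm).trans (le_of_eq ?_)
  rw [ENNReal.tsum_add, ENNReal.tsum_mul_right, ENNReal.tsum_mul_left, p.tsum_coe, one_mul,
    ENNReal.tsum_geometric]

end prior

/-! ### Grid cells of the sieve -/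

section cells

variable {m : ℕ}

/-- The cell, in the grid of mesh size `1 / w`, that contains the coefficients of a parameter. -/
noncomputable def gridCell (w : ℝ) (s : SeriesParam m) : Σ J : ℕ, Fin m → Fin J → ℤ :=
  ⟨s.1, fun k j => ⌊s.2 k j * w⌋⟩

lemma exists_cells_of_sieve (N : ℕ) {B w : ℝ} {W : ℕ} (hw : 0 ≤ w) (hW : B * w ≤ W) :
    ∃ F : Finset (Σ J : ℕ, Fin m → Fin J → ℤ), (∀ s ∈ sieve m N B, gridCell w s ∈ F) ∧
      F.card ≤ (N + 1) * (2 * W + 1) ^ (m * N) := by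
  classical
  refine ⟨(Finset.range (N + 1)).sigma fun J => Fintype.piFinset fun _ => Fintype.piFinset fun _ =>
    Finset.Icc (-(W : ℤ)) W, fun s hs => ?_, ?_⟩
  · simp only [gridCell, Finset.mem_sigma, Finset.mem_range, Fintype.mem_piFinset, Finset.mem_Icc]
    refine ⟨Nat.lt_succ_of_le hs.1, fun k j => ?_⟩
    obtain ⟨h1, h2⟩ := hs.2 k j
    have h3 := mul_le_mul_of_nonneg_right h1 hw
    have h4 := mul_le_mul_of_nonneg_right h2 hw
    constructor
    · rw [Int.le_floor]; push_cast; linarith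
    · have : ((⌊s.2 k j * w⌋ : ℤ) : ℝ) ≤ ((W : ℤ) : ℝ) := by
        push_cast; exact (Int.floor_le _).trans (by linarith)
      exact_mod_cast this
  · rw [Finset.card_sigma]
    calc _ ≤ ∑ _J ∈ Finset.range (N + 1), (2 * W + 1) ^ (m * N) := by
          refine Finset.sum_le_sum fun J hJ => ?_
          have hJ' : J ≤ N := Nat.lt_succ_iff.1 (Finset.mem_range.1 hJ)
          have hc : ((W : ℤ) + 1 + W).toNat = 2 * W + 1 := by omega
          simp only [Fintype.card_piFinset, Int.card_Icc, sub_neg_eq_add, hc, Finset.prod_const,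
            Finset.card_univ, Fintype.card_fin, ← pow_mul]
          rw [mul_comm J m]
          exact Nat.pow_le_pow_right (by omega) (Nat.mul_le_mul_left m hJ')
      _ = _ := by simp

/-- A cell records the dimension, so two parameters in it have coefficients in the same space, with
coordinates less than `1 / w` apart. The crude bound `J / w` on the Euclidean distance raises the
exponent from `K₀` to `K₀ + 1`; this is harmless, as the mesh is polynomially fine. -/
lemma abs_linearPredictor_sub_le_of_gridCell_eq {ψ : (J : ℕ) → Fin J → unitInterval → ℝ} {K₀ C : ℝ}
    (hK₀ : 0 ≤ K₀) (hC : 0 ≤ C)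
    (hbasis : ∀ J : ℕ, 1 ≤ J → ∀ θ₁ θ₂ : EuclideanSpace ℝ (Fin J),
      ∀ t, |series (ψ J) θ₁ t - series (ψ J) θ₂ t| ≤ C * (J : ℝ) ^ K₀ * ‖θ₁ - θ₂‖)
    (hb : ∀ (s : SeriesParam m) l, BoundedMeasurable (s.coeff ψ l))
    {N : ℕ} {B w R : ℝ} (hw : 0 < w) {s s' : SeriesParam m} (hs : s ∈ sieve m N B)
    (h : gridCell w s = gridCell w s') {x : Covariate} (hx : ‖x‖ ≤ R) (l : Fin m) :
    |linearPredictor (s.coeff ψ l) x - linearPredictor (s'.coeff ψ l) x| ≤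
      C * (N : ℝ) ^ (K₀ + 1) / w * R := by
  have key : ∀ t, |s.coeff ψ l t - s'.coeff ψ l t| ≤ C * (N : ℝ) ^ (K₀ + 1) / w := by
    obtain ⟨J, θ⟩ := s
    obtain ⟨J', θ'⟩ := s'
    obtain rfl : J = J' := congrArg Sigma.fst h
    have hfl : (fun k j => ⌊θ k j * w⌋) = fun k j => ⌊θ' k j * w⌋ :=
      eq_of_heq (Sigma.mk.inj h).2
    intro t
    rcases Nat.eq_zero_or_pos J with rfl | hJ
    · simp only [SeriesParam.coeff, series, Finset.univ_eq_empty, Finset.sum_empty, sub_self,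
        abs_zero]
      positivity
    have hJN : (J : ℝ) ≤ N := by exact_mod_cast hs.1
    have hJ0 : (0 : ℝ) < J := by exact_mod_cast hJ
    refine (hbasis J hJ (θ l) (θ' l) t).trans ?_
    have hcoord : ∀ j, ‖(θ l - θ' l) j‖ ≤ 1 / w := fun j => by
      have h1 := Int.abs_sub_lt_one_of_floor_eq_floor (congrFun (congrFun hfl l) j)
      rw [← sub_mul, abs_mul, abs_of_pos hw] at h1
      rw [PiLp.sub_apply, Real.norm_eq_abs, le_div_iff₀ hw]
      exact h1.le
    have hnorm : ‖θ l - θ' l‖ ≤ J * (1 / w) := by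
      rw [EuclideanSpace.norm_eq]
      refine Real.sqrt_le_iff.2 ⟨by positivity, ?_⟩
      calc _ ≤ ∑ _j : Fin J, (1 / w) ^ 2 :=
            Finset.sum_le_sum fun j _ => pow_le_pow_left₀ (norm_nonneg _) (hcoord j) 2
        _ = J * (1 / w) ^ 2 := by simp
        _ ≤ J * J * (1 / w) ^ 2 := by
            have : (1 : ℝ) ≤ J := by exact_mod_cast hJ
            gcongr
            nlinarith
        _ = _ := by ring
    calc _ ≤ C * (J : ℝ) ^ K₀ * (J * (1 / w)) := by gcongr
      _ = C * (J : ℝ) ^ (K₀ + 1) / w := by rw [Real.rpow_add_one hJ0.ne']; ring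
      _ ≤ _ := by gcongr
  refine ((hb s l).abs_linearPredictor_sub_le (hb s' l) key x).trans ?_
  gcongr

end cells

/-! ### Growth of the evidence and entropy scales -/

section scales

/-- The scale `n^e (log n)^{1-e}`, the order of `n` times the squared rate up to logarithms. -/
noncomputable def evidenceScale (e : ℝ) (n : ℕ) : ℝ :=
  (n : ℝ) ^ e * Real.log n ^ (1 - e)

/-- The scale `n^e (log n)^{2-e-t}`, which is `n` times the squared rate. -/
noncomputable def entropyScale (e t : ℝ) (n : ℕ) : ℝ :=
  (n : ℝ) ^ e * Real.log n ^ (2 - e - t)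

variable {e t : ℝ}

lemma tendsto_log_natCast : Tendsto (fun n : ℕ => Real.log n) atTop atTop :=
  Real.tendsto_log_atTop.comp tendsto_natCast_atTop_atTop

lemma eventually_mul_log_le_rpow (C : ℝ) {s : ℝ} (hs : 0 < s) :
    ∀ᶠ n : ℕ in atTop, C * Real.log n ≤ (n : ℝ) ^ s := by
  have h := (isLittleO_log_rpow_atTop hs).comp_tendsto tendsto_natCast_atTop_atTop
  filter_upwards [h.bound (show 0 < (|C| + 1)⁻¹ by positivity),
    tendsto_log_natCast.eventually_ge_atTop 1] with n hn hlog
  simp only [Function.comp_apply] at hn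
  rw [Real.norm_of_nonneg (by linarith), Real.norm_of_nonneg (by positivity),
    ← div_eq_inv_mul, le_div_iff₀ (by positivity)] at hn
  nlinarith [le_abs_self C]

lemma eventually_rpow_le_evidenceScale (he1 : e ≤ 1) :
    ∀ᶠ n : ℕ in atTop, (n : ℝ) ^ e ≤ evidenceScale e n := by
  filter_upwards [tendsto_log_natCast.eventually_ge_atTop 1] with n hlog
  exact le_mul_of_one_le_right (by positivity) (Real.one_le_rpow hlog (by linarith))

lemma tendsto_evidenceScale (he : 0 < e) (he1 : e ≤ 1) :
    Tendsto (evidenceScale e) atTop atTop :=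
  tendsto_atTop_mono' _ (eventually_rpow_le_evidenceScale he1)
    ((tendsto_rpow_atTop he).comp tendsto_natCast_atTop_atTop)

lemma eventually_evidenceScale_le_entropyScale (ht : t ≤ 1) :
    ∀ᶠ n : ℕ in atTop, evidenceScale e n ≤ entropyScale e t n := by
  filter_upwards [tendsto_log_natCast.eventually_ge_atTop 1] with n hlog
  exact mul_le_mul_of_nonneg_left (Real.rpow_le_rpow_of_exponent_le hlog (by linarith))
    (by positivity)

lemma eventually_mul_evidenceScale_le (he1 : e < 1) {C : ℝ} (hC : 0 < C) :
    ∀ᶠ n : ℕ in atTop, C * evidenceScale e n ≤ n := by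
  filter_upwards [eventually_mul_log_le_rpow (C ^ (1 / (1 - e))) one_pos,
    tendsto_log_natCast.eventually_ge_atTop 1, eventually_ge_atTop 1] with n hn hlog hn1
  have hn0 : (0 : ℝ) < n := by exact_mod_cast hn1
  have he' : 0 < 1 - e := by linarith
  have hlog0 : 0 ≤ Real.log n := by linarith
  rw [Real.rpow_one] at hn
  have h1 := Real.rpow_le_rpow (by positivity) hn he'.le
  rw [Real.mul_rpow (by positivity) hlog0, ← Real.rpow_mul hC.le,
    one_div_mul_cancel he'.ne', Real.rpow_one] at h1
  calc _ = (n : ℝ) ^ e * (C * Real.log n ^ (1 - e)) := by rw [evidenceScale]; ring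
    _ ≤ (n : ℝ) ^ e * (n : ℝ) ^ (1 - e) := by gcongr
    _ = n := by rw [← Real.rpow_add hn0]; simp

/-- The number of basis functions that balances approximation error and prior mass. -/
noncomputable def balancedDim (e : ℝ) (n : ℕ) : ℕ :=
  ⌈((n : ℝ) / Real.log n) ^ e⌉₊

lemma tendsto_balancedDim (he : 0 < e) : Tendsto (balancedDim e) atTop atTop := by
  refine tendsto_nat_ceil_atTop.comp ((tendsto_rpow_atTop he).comp ?_)
  refine tendsto_atTop_mono' _ ?_ ((tendsto_rpow_atTop (show (0 : ℝ) < 1 / 2 by norm_num)).comp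
    tendsto_natCast_atTop_atTop)
  filter_upwards [eventually_mul_log_le_rpow 1 (show (0 : ℝ) < 1 / 2 by norm_num),
    tendsto_log_natCast.eventually_ge_atTop 1, eventually_ge_atTop 1] with n hn hlog hn1
  have hn0 : (0 : ℝ) < n := by exact_mod_cast hn1
  simp only [Function.comp_apply]
  rw [le_div_iff₀ (by linarith)]
  calc _ ≤ (n : ℝ) ^ (1 / 2 : ℝ) * (n : ℝ) ^ (1 / 2 : ℝ) := by
        gcongr; linarith
    _ = n := by rw [← Real.rpow_add hn0]; norm_num

/-- Rounding up at most doubles `(n / log n)^e`, the result is at most `n`, and `(n / log n)^e * log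
n` is the evidence scale. -/
lemma eventually_balancedDim (he : 0 < e) (he1 : e < 1) : ∀ᶠ n : ℕ in atTop,
    (balancedDim e n : ℝ) * Real.log (balancedDim e n) ≤ 2 * evidenceScale e n := by
  filter_upwards [eventually_mul_log_le_rpow 1 one_pos,
    tendsto_log_natCast.eventually_ge_atTop 1, eventually_ge_atTop 1] with n hn hlog hn1
  have hn0 : (0 : ℝ) < n := by exact_mod_cast hn1
  rw [one_mul, Real.rpow_one] at hn
  have hlog0 : 0 < Real.log n := by linarith
  have hx1 : 1 ≤ (n : ℝ) / Real.log n := (one_le_div hlog0).2 hn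
  set x := ((n : ℝ) / Real.log n) ^ e with hx
  have hx1' : 1 ≤ x := Real.one_le_rpow hx1 he.le
  have hxn : x ≤ n := calc
    x ≤ ((n : ℝ) / Real.log n) ^ (1 : ℝ) := Real.rpow_le_rpow_of_exponent_le hx1 he1.le
    _ ≤ n := by rw [Real.rpow_one]; exact div_le_self hn0.le hlog
  have hj1 : x ≤ balancedDim e n := Nat.le_ceil _
  have hj2 : (balancedDim e n : ℝ) ≤ 2 * x := by
    have := Nat.ceil_lt_add_one (a := x) (by linarith)
    simp only [balancedDim]
    linarith
  have hj3 : (balancedDim e n : ℝ) ≤ n := by exact_mod_cast Nat.ceil_le.2 hxn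
  calc _ ≤ 2 * x * Real.log n := by
        gcongr
        linarith
    _ = 2 * evidenceScale e n := by
        rw [hx, Real.div_rpow hn0.le hlog0.le, evidenceScale, Real.rpow_sub hlog0, Real.rpow_one]
        ring

/-- The exponent `e = 1 / (2α + 1)` solves `1 - 2αe = e`, so the squared approximation error times
`n` has the same order as the prior cost. -/
lemma eventually_mul_balancedDim_sq_le {α : ℝ} (hα : 0 < α) : ∀ᶠ n : ℕ in atTop,
    (n : ℝ) * ((balancedDim (1 / (2 * α + 1)) n : ℝ) ^ (-α)) ^ 2 ≤
      evidenceScale (1 / (2 * α + 1)) n := by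
  filter_upwards [tendsto_log_natCast.eventually_ge_atTop 1, eventually_ge_atTop 1]
    with n hlog hn1
  have hn0 : (0 : ℝ) < n := by exact_mod_cast hn1
  have hlog0 : 0 < Real.log n := by linarith
  set e := 1 / (2 * α + 1) with he
  have hex : e * (-α * 2) = e - 1 := by rw [he]; field_simp; ring
  have hj1 : ((n : ℝ) / Real.log n) ^ e ≤ balancedDim e n := Nat.le_ceil _
  have hpos : 0 < ((n : ℝ) / Real.log n) ^ e := by positivity
  calc _ ≤ (n : ℝ) * ((((n : ℝ) / Real.log n) ^ e) ^ (-α)) ^ 2 := by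
        exact mul_le_mul_of_nonneg_left (pow_le_pow_left₀ (by positivity)
          (Real.rpow_le_rpow_of_nonpos hpos hj1 (neg_nonpos.2 hα.le)) 2) hn0.le
    _ = evidenceScale e n := by
        rw [← Real.rpow_natCast, ← Real.rpow_mul hpos.le, ← Real.rpow_mul (by positivity)]
        push_cast
        rw [hex, Real.div_rpow hn0.le hlog0.le, evidenceScale, Real.rpow_sub hn0, Real.rpow_one,
          ← neg_sub 1 e, Real.rpow_neg hlog0.le]
        field_simp

/-- The number of basis functions in the sieve. -/
noncomputable def sieveDim (L e t : ℝ) (n : ℕ) : ℕ :=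
  ⌈L * evidenceScale e n * Real.log n ^ (-t)⌉₊

/-- The polynomial lower bound gives `log N ≥ (e/2) log n`, hence `N log^t N` is at least a multiple
of the evidence scale, and the multiple can be made large through `L`. At the same time `(N + 1) log
n` is of the order of the entropy scale. The last claim supplies the factor `≥ 1` for the geometric
series of the dimension prior. -/
lemma eventually_sieveDim {L : ℝ} (hL : 0 < L) (he : 0 < e) (he1 : e < 1) (ht0 : 0 ≤ t)
    (ht : t ≤ 1) : ∀ᶠ n : ℕ in atTop,
      (n : ℝ) ^ (e / 2) ≤ sieveDim L e t n ∧ sieveDim L e t n ≤ n ∧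
      ((sieveDim L e t n : ℝ) + 1) * Real.log n ≤ (L + 2) * entropyScale e t n ∧
      L * (e / 2) * evidenceScale e n ≤ sieveDim L e t n * Real.log (sieveDim L e t n) ^ t ∧
      1 ≤ Real.log (sieveDim L e t n) ^ t := by
  filter_upwards [eventually_mul_log_le_rpow L⁻¹ (half_pos he), eventually_mul_log_le_rpow 1 he,
    eventually_mul_evidenceScale_le he1 (show 0 < L by positivity),
    tendsto_log_natCast.eventually_ge_atTop 1, tendsto_log_natCast.eventually_ge_atTop (2 / e),
    eventually_ge_atTop 1]
    with n h1 h2 h3 hlog hloge hn1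
  have hn0 : (0 : ℝ) < n := by exact_mod_cast hn1
  have hlog0 : 0 < Real.log n := by linarith
  have hT0 : 0 < evidenceScale e n := by unfold evidenceScale; positivity
  set y := L * evidenceScale e n * Real.log n ^ (-t) with hy
  have hy0 : 0 ≤ y := by positivity
  have hyN : y ≤ sieveDim L e t n := Nat.le_ceil _
  have hNy : (sieveDim L e t n : ℝ) ≤ y + 1 := (Nat.ceil_lt_add_one hy0).le
  have hyT : y ≤ L * evidenceScale e n := by
    rw [hy]
    refine mul_le_of_le_one_right (by positivity) ?_
    exact Real.rpow_le_one_of_one_le_of_nonpos hlog (by linarith)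
  have hyL : y * Real.log n = L * entropyScale e t n := by
    rw [hy, evidenceScale, entropyScale, mul_assoc, mul_assoc, mul_assoc, ← Real.rpow_add_one hlog0.ne',
      ← Real.rpow_add hlog0]
    congr 3; ring
  have hlow : (n : ℝ) ^ (e / 2) ≤ y := by
    rw [hy, evidenceScale]
    have ha : (n : ℝ) ^ e = (n : ℝ) ^ (e / 2) * (n : ℝ) ^ (e / 2) := by
      rw [← Real.rpow_add hn0]; congr 1; ring
    have hb : (Real.log n)⁻¹ ≤ Real.log n ^ (1 - e) * Real.log n ^ (-t) := by
      rw [← Real.rpow_add hlog0, ← Real.rpow_neg_one]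
      exact Real.rpow_le_rpow_of_exponent_le hlog (by linarith)
    have hc : 1 ≤ L * (n : ℝ) ^ (e / 2) * (Real.log n)⁻¹ := by
      rw [← div_eq_mul_inv, one_le_div hlog0]
      rwa [inv_mul_le_iff₀ hL] at h1
    calc (n : ℝ) ^ (e / 2) = (n : ℝ) ^ (e / 2) * 1 := by ring
      _ ≤ (n : ℝ) ^ (e / 2) * (L * (n : ℝ) ^ (e / 2) * (Real.log n)⁻¹) := by gcongr
      _ ≤ (n : ℝ) ^ (e / 2) * (L * (n : ℝ) ^ (e / 2) *
          (Real.log n ^ (1 - e) * Real.log n ^ (-t))) := by gcongr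
      _ = _ := by rw [ha]; ring
  have hlogN : e / 2 * Real.log n ≤ Real.log (sieveDim L e t n) := by
    rw [← Real.log_rpow hn0]
    exact Real.log_le_log (by positivity) (hlow.trans hyN)
  have hel : 1 ≤ e / 2 * Real.log n := by
    rw [div_le_iff₀ he] at hloge; linarith
  refine ⟨hlow.trans hyN, Nat.ceil_le.2 (hyT.trans h3), ?_, ?_, ?_⟩
  · have hv : Real.log n ≤ entropyScale e t n := by
      rw [one_mul] at h2
      refine h2.trans (le_mul_of_one_le_right (by positivity) (Real.one_le_rpow hlog ?_))
      linarith
    calc _ ≤ (y + 1 + 1) * Real.log n := by gcongr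
      _ = L * entropyScale e t n + 2 * Real.log n := by rw [← hyL]; ring
      _ ≤ _ := by linarith
  · calc L * (e / 2) * evidenceScale e n ≤ L * (e / 2) ^ t * evidenceScale e n := by
          gcongr
          simpa using Real.rpow_le_rpow_of_exponent_ge (by positivity : 0 < e / 2)
            (by linarith) ht
      _ = y * (e / 2 * Real.log n) ^ t := by
          rw [hy, Real.mul_rpow (by positivity) hlog0.le, Real.rpow_neg hlog0.le]
          field_simp
      _ ≤ _ := by gcongr
  · exact Real.one_le_rpow (hel.trans hlogN) ht0

lemma mul_rate_sq {α : ℝ} (hα : 0 < α) {n : ℕ} (hn : 1 ≤ n) :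
    (n : ℝ) * ((n : ℝ) ^ (-(α / (2 * α + 1))) *
      Real.log n ^ (α / (2 * α + 1) + (1 - t) / 2)) ^ 2 =
      entropyScale (1 / (2 * α + 1)) t n := by
  have hn0 : (0 : ℝ) < n := by exact_mod_cast hn
  have hlog0 : 0 ≤ Real.log n := Real.log_natCast_nonneg n
  rw [mul_pow, ← Real.rpow_natCast, ← Real.rpow_natCast, ← Real.rpow_mul hn0.le,
    ← Real.rpow_mul hlog0, ← mul_assoc, mul_comm (n : ℝ), ← Real.rpow_add_one hn0.ne', entropyScale]
  congr 2
  · push_cast; field_simp; ring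
  · push_cast; field_simp; ring

end scales

/-! ### Choice of constants and conclusion -/

lemma exists_ofReal_exp_neg_le {δ : ℝ≥0∞} (hδ : 0 < δ) :
    ∃ τ : ℝ, ENNReal.ofReal (Real.exp (-τ)) ≤ δ := by
  rcases eq_or_ne δ ∞ with rfl | h
  · exact ⟨0, le_top⟩
  · refine ⟨-Real.log δ.toReal, ?_⟩
    rw [neg_neg, Real.exp_log (ENNReal.toReal_pos hδ.ne' h), ENNReal.ofReal_toReal h]

lemma tendsto_ofReal_exp_neg {f : ℕ → ℝ} (hf : Tendsto f atTop atTop) :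
    Tendsto (fun n => ENNReal.ofReal (Real.exp (-f n))) atTop (𝓝 0) := by
  have := ENNReal.tendsto_ofReal (Real.tendsto_exp_neg_atTop_nhds_zero.comp hf)
  simpa using this

lemma tendsto_ofReal_mul_exp_neg_half :
    Tendsto (fun n : ℕ => ENNReal.ofReal (n * Real.exp (-((n : ℝ) / 2)))) atTop (𝓝 0) := by
  have h := ((Real.tendsto_pow_mul_exp_neg_atTop_nhds_zero 1).comp
    ((tendsto_natCast_atTop_atTop (R := ℝ)).atTop_div_const (show (0 : ℝ) < 2 by norm_num))).const_mul 2
  have h2 := ENNReal.tendsto_ofReal h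
  rw [mul_zero, ENNReal.ofReal_zero] at h2
  refine h2.congr fun n => ?_
  simp only [Function.comp_apply, pow_one]
  congr 1; ring

/-- A polynomial number of grid points per coordinate costs a factor `log n` in the entropy. -/
lemma cells_card_le_exp {m N W n d : ℕ} (hn : 2 ≤ n) (hlog : 1 ≤ Real.log n) (hW : W ≤ n ^ d) :
    (((N + 1) * (2 * W + 1) ^ (m * N) : ℕ) : ℝ) ≤
      Real.exp ((1 + m * (d + 2)) * ((N + 1) * Real.log n)) := by
  have hn0 : (0 : ℝ) < n := by positivity
  have h1 : ((N : ℝ) + 1) ≤ Real.exp ((N + 1) * Real.log n) := by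
    refine le_trans ?_ (Real.add_one_le_exp _)
    nlinarith
  have h2 : ((2 * W + 1 : ℕ) : ℝ) ≤ Real.exp ((d + 2) * Real.log n) := by
    have h3 : 2 * W + 1 ≤ n ^ (d + 2) := by
      have : 1 ≤ n ^ d := Nat.one_le_pow _ _ (by omega)
      have h4 : 4 ≤ n ^ 2 := by nlinarith
      rw [pow_add]
      nlinarith [Nat.mul_le_mul_left (n ^ d) h4]
    calc ((2 * W + 1 : ℕ) : ℝ) ≤ ((n ^ (d + 2) : ℕ) : ℝ) := by exact_mod_cast h3
      _ = Real.exp (((d + 2 : ℕ) : ℝ) * Real.log n) := by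
        rw [Real.exp_nat_mul, Real.exp_log hn0, Nat.cast_pow]
      _ = _ := by push_cast; rfl
  calc (((N + 1) * (2 * W + 1) ^ (m * N) : ℕ) : ℝ)
      = ((N : ℝ) + 1) * ((2 * W + 1 : ℕ) : ℝ) ^ (m * N) := by push_cast; ring
    _ ≤ Real.exp ((N + 1) * Real.log n) * Real.exp ((d + 2) * Real.log n) ^ (m * N) := by gcongr
    _ = Real.exp ((N + 1) * Real.log n + (m * N : ℕ) * ((d + 2) * Real.log n)) := by
        rw [Real.exp_add, Real.exp_nat_mul]
    _ ≤ _ := by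
        refine Real.exp_le_exp.2 ?_
        push_cast
        have : 0 ≤ (m : ℝ) * ((d + 2) * Real.log n) := by positivity
        nlinarith

/-- Posterior contraction for finite random series priors in the multinomial logistic model. -/
theorem posteriorContractsAtRate_seriesPrior {m : ℕ}
    (G : Measure Covariate) [IsProbabilityMeasure G]
    (hG : ∃ R : ℝ, ∀ᵐ x ∂G, ‖x‖ ≤ R)
    (ψ : (J : ℕ) → Fin J → unitInterval → ℝ) (hψ : ∀ J j, Measurable (ψ J j))
    (β₀ : Fin m → unitInterval → ℝ)
    (p : PMF ℕ) (Q : (J : ℕ) → Fin m → Measure (EuclideanSpace ℝ (Fin J)))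
    [∀ J k, IsProbabilityMeasure (Q J k)]
    (t₁ t₂ H α K₀ : ℝ) (hα : 0 < α) (hK₀ : 0 ≤ K₀)
    (hp : DimensionPriorCondition p t₁ t₂)
    (hmass : ∀ k, CoefficientMassCondition (fun J => Q J k) H)
    (htail : ∀ k, CoefficientTailCondition fun J => Q J k)
    (happrox : ∀ k, ApproximationCondition ψ (β₀ k) H α)
    (hbasis : BasisLipschitzCondition ψ K₀)
    (ε : ℕ → ℝ) (hε : ∀ n, 0 < ε n)
    (hrate : (fun n : ℕ => (n : ℝ) ^ (-(α / (2 * α + 1))) *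
        Real.log n ^ (α / (2 * α + 1) + (1 - t₂) / 2)) =O[atTop] ε) :
    PosteriorContractsAtRate G ψ (seriesPrior p Q) β₀ ε := by
  classical
  intro M hM δ hδ
  obtain ⟨τ, hτ⟩ := exists_ofReal_exp_neg_le hδ
  have hb : ∀ (s : SeriesParam m) l, BoundedMeasurable (s.coeff ψ l) :=
    fun s l => boundedMeasurable_series hψ hbasis _
  have hβ₀ : ∀ l, BoundedMeasurable (β₀ l) := fun l => (happrox l).boundedMeasurable hα hψ hbasis
  obtain ⟨R, hR0, hR⟩ : ∃ R : ℝ, 0 ≤ R ∧ ∀ᵐ x ∂G, ‖x‖ ≤ R := by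
    obtain ⟨R, hR⟩ := hG
    exact ⟨max R 0, le_max_right _ _, hR.mono fun x hx => hx.trans (le_max_left _ _)⟩
  obtain ⟨C, hC, hA⟩ := exists_prior_mass (p := p) (Q := Q) hα hK₀ hp hmass happrox hbasis
  obtain ⟨ht0, ht12, ht1, c₁, -, c₂, hc₂, hp⟩ := hp
  have ht2 : t₂ ≤ 1 := ht12.trans ht1
  obtain ⟨q, hq⟩ : ∃ q : ℕ, ∀ k, ∀ᶠ n : ℕ in atTop, ∀ J : ℕ, 1 ≤ J →
      Q J k {θ | ¬ ∀ j, θ j ∈ Set.Icc (-(n : ℝ) ^ q) ((n : ℝ) ^ q)} ≤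
        ENNReal.ofReal (J * Real.exp (-n)) := by
    choose q₀ hq₀ using fun k => exists_pow_tail_le (htail k)
    exact ⟨∑ k, q₀ k, fun k => hq₀ k _
      (Finset.single_le_sum (fun _ _ => Nat.zero_le _) (Finset.mem_univ k))⟩
  obtain ⟨Cb, hCb, hbas⟩ := id hbasis
  obtain ⟨κ, hκ, hrate⟩ := hrate.exists_pos
  rw [Asymptotics.isBigOWith_iff] at hrate
  set e := 1 / (2 * α + 1) with he
  have he0 : 0 < e := by positivity
  have he1 : e < 1 := by rw [he, div_lt_one] <;> linarith
  -- Converts a supremum distance `C * j^(-α)` into a distance `D * j^(-α)` of linear predictors.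
  set D := C * R with hD
  have hD0 : 0 ≤ D := by positivity
  -- Cost of the evidence: `2 * C` from the prior mass, as `j log j ≤ 2 T`, and `16 * D² + 1` so
  -- that a factor `exp (-T)` remains after the chi-square term.
  set C₁ := 2 * C + (16 * D ^ 2 + 1) with hC₁
  have hC₁0 : 0 < C₁ := by positivity
  -- Chosen so that `c₂ / 2 * (L * (e / 2)) = C₁ + 1`: the mass of dimensions above the sieve beats
  -- the evidence cost by `exp (-T)`.
  set L := (C₁ + 1) * (2 / c₂) * (2 / e) with hL
  have hL0 : 0 < L := by positivity
  -- Mesh exponent: `K₀ + 1` for the Lipschitz factor, one power of `n` for the required accuracy `1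
  -- / (2 n)`, and one to absorb the constant `2 * (Cb * R)`.
  set u := ⌈K₀⌉₊ + 3 with hu
  set C₃ : ℝ := 1 + m * ((q + u : ℕ) + 2) with hC₃
  have hC₃0 : 0 < C₃ := by positivity
  set T := evidenceScale e with hT
  set v := entropyScale e t₂ with hv
  have hTlim : Tendsto T atTop atTop := tendsto_evidenceScale he0 he1.le
  have hTv : ∀ᶠ n in atTop, T n ≤ v n := eventually_evidenceScale_le_entropyScale ht2
  have hvlim : Tendsto v atTop atTop := tendsto_atTop_mono' _ hTv hTlim
  set K : ℝ≥0∞ := (1 - ENNReal.ofReal (Real.exp (-(c₂ / 2))))⁻¹ with hK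
  have hKtop : K ≠ ∞ := by
    rw [hK, ENNReal.inv_ne_top]
    refine (tsub_pos_of_lt ?_).ne'
    rw [← ENNReal.ofReal_one, ENNReal.ofReal_lt_ofReal_iff one_pos, Real.exp_lt_one_iff]
    linarith
  set U : ℕ → ℝ≥0∞ := fun n => ENNReal.ofReal (Real.exp (-T n)) +
    ((ENNReal.ofReal (Real.exp (τ + 1)) * m * ENNReal.ofReal (n * Real.exp (-((n : ℝ) / 2))) +
      ENNReal.ofReal (Real.exp (τ + 1)) * K * ENNReal.ofReal (Real.exp (-T n))) +
      ENNReal.ofReal (Real.exp (-v n))) with hU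
  have hUlim : Tendsto U atTop (𝓝 0) := by
    have h1 := tendsto_ofReal_exp_neg hTlim
    have h2 := ENNReal.Tendsto.const_mul (a := ENNReal.ofReal (Real.exp (τ + 1)) * m)
      tendsto_ofReal_mul_exp_neg_half
      (Or.inr (ENNReal.mul_ne_top ENNReal.ofReal_ne_top (ENNReal.natCast_ne_top m)))
    have h3 := ENNReal.Tendsto.const_mul (a := ENNReal.ofReal (Real.exp (τ + 1)) * K)
      h1 (Or.inr (ENNReal.mul_ne_top ENNReal.ofReal_ne_top hKtop))
    have h4 := h1.add ((h2.add h3).add (tendsto_ofReal_exp_neg hvlim))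
    simp only [mul_zero, add_zero] at h4
    exact h4
  refine tendsto_of_tendsto_of_tendsto_of_le_of_le' tendsto_const_nhds hUlim
    (Eventually.of_forall fun _ => zero_le) ?_
  have hjlim := tendsto_balancedDim he0
  have hδlim : ∀ᶠ n : ℕ in atTop, D * (balancedDim e n : ℝ) ^ (-α) ≤ 1 / 2 := by
    have := ((tendsto_rpow_neg_atTop hα).comp
      (tendsto_natCast_atTop_atTop.comp hjlim)).const_mul D
    rw [mul_zero] at this
    exact (this.eventually (gt_mem_nhds (show (0 : ℝ) < 1 / 2 by norm_num))).mono fun n hn => hn.le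
  have hNlim : Tendsto (sieveDim L e t₂) atTop atTop := by
    have h1 : Tendsto (fun n : ℕ => (n : ℝ) ^ (e / 2)) atTop atTop :=
      (tendsto_rpow_atTop (half_pos he0)).comp tendsto_natCast_atTop_atTop
    refine tendsto_natCast_atTop_iff.1 (tendsto_atTop_mono' _ ?_ h1)
    exact (eventually_sieveDim hL0 he0 he1 ht0 ht2).mono fun n hn => hn.1
  have hMlim : ∀ᶠ n in atTop, 8 * κ ^ 2 * (C₃ * (L + 2) + C₁ + |τ| + 3) ≤ M n ^ 2 :=
    ((tendsto_pow_atTop two_ne_zero).comp hM).eventually_ge_atTop _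
  filter_upwards [hjlim.eventually hA, eventually_balancedDim he0 he1,
    eventually_mul_balancedDim_sq_le hα, hδlim, eventually_sieveDim hL0 he0 he1 ht0 ht2,
    hNlim.eventually (eventually_forall_ge_atTop.2 hp), eventually_all.2 hq, hTv,
    hvlim.eventually_ge_atTop 1, eventually_mul_evidenceScale_le he1 (show 0 < 2 * C₁ by positivity),
    hMlim, hM.eventually_ge_atTop 0, hrate, tendsto_log_natCast.eventually_ge_atTop 1,
    eventually_ge_atTop 2, tendsto_natCast_atTop_atTop.eventually_ge_atTop (2 * (Cb * R))]
    with n hAn hjn hjn2 hδn hNn hpn hqn hTvn hvn hTn hMn hM0 hraten hlog hn2 hnCb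
  obtain ⟨A, hA1, hA2⟩ := hAn
  obtain ⟨hNge, hNle, hNent, hNmass, hNlog⟩ := hNn
  set N := sieveDim L e t₂ n with hN
  set δn := D * (balancedDim e n : ℝ) ^ (-α) with hδn_def
  have hn1 : (1 : ℝ) ≤ n := by exact_mod_cast (by omega : 1 ≤ n)
  have hn0 : (0 : ℝ) < n := by linarith
  have hN0 : (0 : ℝ) < N := lt_of_lt_of_le (by positivity) hNge
  have hT0 : 0 ≤ T n := by rw [hT, evidenceScale]; positivity
  obtain ⟨F, hF, hFcard⟩ := exists_cells_of_sieve (m := m) N (B := (n : ℝ) ^ q) (w := (n : ℝ) ^ u)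
    (W := n ^ (q + u)) (by positivity) (by rw [← pow_add, Nat.cast_pow])
  have hη : Cb * (N : ℝ) ^ (K₀ + 1) / (n : ℝ) ^ u * R ≤ 1 / (2 * n) := by
    have h1 : (N : ℝ) ^ (K₀ + 1) ≤ (n : ℝ) ^ (K₀ + 1) := by gcongr
    have h2 : (n : ℝ) ^ (K₀ + 1) * n * n ≤ (n : ℝ) ^ u := by
      rw [← Real.rpow_add_one hn0.ne', ← Real.rpow_add_one hn0.ne', ← Real.rpow_natCast]
      refine Real.rpow_le_rpow_of_exponent_le hn1 ?_
      rw [hu]; push_cast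
      linarith [Nat.le_ceil K₀]
    rw [le_div_iff₀ (by positivity), div_mul_eq_mul_div, div_mul_eq_mul_div,
      div_le_one (by positivity)]
    calc _ = 2 * (Cb * R) * ((N : ℝ) ^ (K₀ + 1) * n) := by ring
      _ ≤ n * ((n : ℝ) ^ (K₀ + 1) * n) := by gcongr
      _ = (n : ℝ) ^ (K₀ + 1) * n * n := by ring
      _ ≤ _ := h2
  have main := sampleLaw_posterior_ge_le (n := n) (Pr := seriesPrior p Q) (ψ := ψ) (γ := β₀)
    (A := A) (B := {s | M n * ε n ≤ probDist G (s.coeff ψ) β₀})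
    (V := sieve m N ((n : ℝ) ^ q)) hb hβ₀ (measurable_sampleRatio_coeff hψ hbasis hβ₀) hR
    (gridCell ((n : ℝ) ^ u)) F hF (η := 1 / (2 * n)) (by positivity)
    (by field_simp; rfl)
    (fun s hs s' _ h x hx l => (abs_linearPredictor_sub_le_of_gridCell_eq hK₀ hCb.le hbas hb
      (by positivity) hs h hx l).trans hη)
    (r := M n * ε n) (mul_nonneg hM0 (hε n).le) (fun s hs => hs)
    (δ := δn) (a := 2 * C * T n) (by positivity) hδn
    (fun s hs => by
      filter_upwards [hR] with x hx l
      refine ((hb s l).abs_linearPredictor_sub_le (hβ₀ l) (hA2 s hs l) x).trans ?_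
      rw [hδn_def, hD, mul_right_comm]
      gcongr)
    (le_trans (ENNReal.ofReal_le_ofReal (Real.exp_le_exp.2 (by
      have := mul_le_mul_of_nonneg_left hjn hC.le
      linarith))) hA1) ((16 * D ^ 2 + 1) * T n) τ
  refine (measure_mono fun z hz => hτ.trans hz).trans (main.trans ?_)
  have hsum : 2 * C * T n + (16 * D ^ 2 + 1) * T n = C₁ * T n := by rw [hC₁]; ring
  rw [hsum]
  refine add_le_add (ENNReal.ofReal_le_ofReal (Real.exp_le_exp.2 ?_)) (add_le_add ?_ ?_)
  · have : 16 * n * δn ^ 2 = 16 * D ^ 2 * (n * ((balancedDim e n : ℝ) ^ (-α)) ^ 2) := by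
      rw [hδn_def]; ring
    rw [this]
    have := mul_le_mul_of_nonneg_left hjn2 (by positivity : 0 ≤ 16 * D ^ 2)
    linarith
  · have hsieve := seriesPrior_sieve_compl_le (m := m) (p := p) (Q := Q) (N := N) (B := (n : ℝ) ^ q)
      (e := ENNReal.ofReal (n * Real.exp (-n))) hc₂ hNlog
      (fun J hJ hJN k => (hqn k J hJ).trans (ENNReal.ofReal_le_ofReal (by gcongr; exact hJN.trans hNle)))
      (fun J hJ => (hpn J hJ.le).2.trans (Real.exp_le_exp.2 (by
        have h1 : Real.log N ^ t₂ ≤ Real.log J ^ t₂ :=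
          Real.rpow_le_rpow (Real.log_natCast_nonneg N)
            (Real.log_le_log hN0 (by exact_mod_cast hJ.le)) ht0
        have h2 := mul_le_mul_of_nonneg_left h1 (by positivity : 0 ≤ c₂ * (J : ℝ))
        linarith)))
    refine (mul_le_mul_right hsieve _).trans ?_
    rw [mul_add]
    refine add_le_add ?_ ?_
    · rw [mul_left_comm, mul_comm _ (m : ℝ≥0∞), mul_assoc, ← ENNReal.ofReal_mul (Real.exp_pos _).le,
        ← ENNReal.ofReal_mul (Real.exp_pos _).le]
      refine mul_le_mul_right (ENNReal.ofReal_le_ofReal ?_) _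
      calc _ = n * Real.exp (C₁ * T n + τ + 1 + -n) := by rw [Real.exp_add _ (-(n : ℝ))]; ring
        _ ≤ n * Real.exp (τ + 1 + -((n : ℝ) / 2)) := by
            -- Since `2 * C₁ * T n ≤ n`, the evidence cost consumes at most half of the coefficient
            -- tail `exp (-n)`.
            gcongr n * Real.exp ?_
            linarith
        _ = _ := by rw [Real.exp_add]; ring
    · rw [← mul_assoc, mul_right_comm _ K, ← ofReal_exp_add, ← ofReal_exp_add]
      refine mul_le_mul_left (ENNReal.ofReal_le_ofReal (Real.exp_le_exp.2 ?_)) _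
      have h1 : c₂ / 2 * (L * (e / 2) * T n) = (C₁ + 1) * T n := by
        rw [hL]; field_simp
      have h2 := mul_le_mul_of_nonneg_left hNmass (by positivity : 0 ≤ c₂ / 2)
      rw [h1] at h2
      linarith
  · have hcard : (F.card : ℝ≥0∞) ≤ ENNReal.ofReal (Real.exp (C₃ * ((L + 2) * v n))) := by
      rw [← ENNReal.ofReal_natCast]
      refine ENNReal.ofReal_le_ofReal ?_
      calc (F.card : ℝ) ≤ (((N + 1) * (2 * n ^ (q + u) + 1) ^ (m * N) : ℕ) : ℝ) := by
            exact_mod_cast hFcard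
        _ ≤ _ := cells_card_le_exp hn2 hlog le_rfl
        _ ≤ _ := Real.exp_le_exp.2 (mul_le_mul_of_nonneg_left hNent hC₃0.le)
    refine (mul_le_mul_left hcard _).trans ?_
    rw [← ofReal_exp_add]
    refine ENNReal.ofReal_le_ofReal (Real.exp_le_exp.2 ?_)
    have hvε : v n ≤ κ ^ 2 * (n * ε n ^ 2) := by
      rw [hv, ← mul_rate_sq hα (by omega : 1 ≤ n)]
      rw [Real.norm_of_nonneg (by positivity), Real.norm_of_nonneg (hε n).le] at hraten
      calc _ ≤ (n : ℝ) * (κ * ε n) ^ 2 := by gcongr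
        _ = _ := by ring
    -- As `M n` tends to infinity, `n (M n * ε n)² / 8` exceeds any fixed multiple of `v n`. The
    -- multiple covers the entropy `C₃ * (L + 2)`, the evidence `C₁`, the level `τ` and the additive
    -- constants (using `v n ≥ 1`), with `exp (-v n)` left over.
    have h1 := mul_le_mul hMn hvε (by linarith) (by positivity)
    have h2 : (C₃ * (L + 2) + C₁ + |τ| + 3) * v n ≤ n * (M n * ε n) ^ 2 / 8 := by
      have hκ2 : 0 < κ ^ 2 := by positivity
      refine le_of_mul_le_mul_left ?_ hκ2
      calc _ = 8 * κ ^ 2 * (C₃ * (L + 2) + C₁ + |τ| + 3) * v n / 8 := by ring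
        _ ≤ M n ^ 2 * (κ ^ 2 * (n * ε n ^ 2)) / 8 := by gcongr
        _ = _ := by ring
    have h3 : C₁ * T n ≤ C₁ * v n := by gcongr
    have h4 : |τ| ≤ |τ| * v n := le_mul_of_one_le_right (abs_nonneg _) hvn
    have h5 := le_abs_self τ
    have h6 : 0 ≤ C₁ * T n := by positivity
    have h7 := abs_nonneg τ
    linarith

theorem theorem4 {m : ℕ}
    (G : Measure Covariate) [IsProbabilityMeasure G]
    (hG : ∃ R : ℝ, ∀ᵐ x ∂G, ‖x‖ ≤ R)
    (ψ : (J : ℕ) → Fin J → unitInterval → ℝ) (hψ : ∀ J j, Measurable (ψ J j))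
    (β₀ : Fin m → unitInterval → ℝ)
    (p : PMF ℕ) (Q : (J : ℕ) → Fin m → Measure (EuclideanSpace ℝ (Fin J)))
    [∀ J k, IsProbabilityMeasure (Q J k)]
    (t₁ t₂ H α K₀ : ℝ) (hα : 0 < α) (hK₀ : 0 ≤ K₀)
    (hp : DimensionPriorCondition p t₁ t₂)
    (hQ : ∀ k, CoefficientPriorCondition (fun J => Q J k) H)
    (happrox : ∀ k, ApproximationCondition ψ (β₀ k) H α)
    (hbasis : BasisLipschitzCondition ψ K₀)
    (ε : ℕ → ℝ) (hε : ∀ n, 0 < ε n)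
    (hrate : ε =Θ[atTop] fun n : ℕ =>
      (n : ℝ) ^ (-(α / (2 * α + 1))) *
        Real.log n ^ (α / (2 * α + 1) + (1 - t₂) / 2)) :
    PosteriorContractsAtRate G ψ (seriesPrior p Q) β₀ ε := by
  refine posteriorContractsAtRate_seriesPrior G hG ψ hψ β₀ p Q t₁ t₂ H α K₀ hα hK₀ hp
    (fun k => (hQ k).1) (fun k => ?_) happrox hbasis ε hε hrate.2
  obtain ⟨-, C, hC, t, ht, h⟩ := hQ k
  -- The tail exponent in `CoefficientPriorCondition` elaborates as a natural number and is cast to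
  -- the real exponent of `CoefficientTailCondition`.
  refine ⟨C, hC, t, by exact_mod_cast ht, ?_⟩
  simpa only [Real.rpow_natCast] using h
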